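/- Let $E$ be a finite-dimensional complex Banach space, equip the bounded operators on $E$ with the operator norm, and let $T>0$. Let $\mathcal{L}_0$ be a bounded operator on $E$ generating a contraction semigroup, i.e. $\|e^{t\mathcal{L}_0}\|\le 1$ for all $t\ge 0$, and let $\mathcal{P}_\varphi=\sum_{\alpha\in\sigma(\mathcal{L}_0)\cap i\mathbb{R}}\mathcal{P}_\alpha$ be its peripheral projection, where $\mathcal{P}_\alpha$ is the spectral projection of $\mathcal{L}_0$ at $\alpha$ (the projection onto the generalized eigenspace at $\alpha$ along the sum of the other generalized eigenspaces). For a continuous family $\mathcal{A}(u)$ of operators on $E$, let $$\operatorname{T}\exp\Bigl(\int_0^t \mathcal{A}(u)\,du\Bigr)=1+\sum_{n\ge1}\int_0^t du_1\int_0^{u_1}du_2\cdots\int_0^{u_{n-1}}du_n\,\mathcal{A}(u_1)\cdots\mathcal{A}(u_n)$$ denote the propagator from time $0$ to time $t$ generated by $\mathcal{A}$ (Dyson series). Let $\mathcal{D}(t,s)$, for $t\in[0,T]$ and $s\ge0$, be operators on $E$ depending on $(t,s)$ in a continuously differentiable way and uniformly bounded in norm. For $\tau>0$ put $$\overline{\mathcal{D}}(t,\tau)=\frac1\tau\int_0^\tau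 e^{-s\mathcal{L}_0}\mathcal{P}_\varphi\,\mathcal{D}(t,s)\,\mathcal{P}_\varphi e^{s\mathcal{L}_0}\,ds ,$$ and suppose that there is a differentiable family $t\mapsto\overline{\mathcal{D}}(t)$ on $[0,T]$ such that, as $\tau\to+\infty$, $$\overline{\mathcal{D}}(t,\tau)\to\overline{\mathcal{D}}(t)\quad\text{and}\quad \partial_t\overline{\mathcal{D}}(t,\tau)\to\partial_t\overline{\mathcal{D}}(t),\qquad\text{uniformly for } t\in[0,T].$$ For $\kappa>0$ let $$\Lambda_\kappa(t)=\operatorname{T}\exp\Bigl(\int_0^t\bigl[\kappa\mathcal{L}_0+\mathcal{D}(s,\kappa s)\bigr]\,ds\Bigr).$$ Then $$\Lambda_\kappa(t)-e^{\kappa t\mathcal{L}_0}\,\operatorname{T}\exp\Bigl(\int_0^t\overline{\mathcal{D}}(s)\,ds\Bigr)\to0\qquad\text{as }\kappa\to+\infty,$$ uniformly for $t\in[0,T]$. -/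

import Mathlib

open Filter Set Topology

noncomputable section

section Spectral

variable {E : Type*} [NormedAddCommGroup E] [NormedSpace ℂ E]

/-- The bounded operator `L` generates a contraction semigroup: `‖e^{tL}‖ ≤ 1` for all `t ≥ 0`. -/
def GeneratesContractionSemigroup (L : E →L[ℂ] E) : Prop :=
  ∀ t : ℝ, 0 ≤ t → ‖NormedSpace.exp (t • L)‖ ≤ 1

/-- The generalized eigenspace (algebraic eigenspace) of `L` for the complex number `α`;
it is `{0}` if `α` is not an eigenvalue. -/
def genEigenspaceAt (L : E →L[ℂ] E) (α : ℂ) : Submodule ℂ E :=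
  Module.End.maxGenEigenspace (L : E →ₗ[ℂ] E) α

variable [FiniteDimensional ℂ E]

/-- In finite dimension, the generalized eigenspace at `α` is complemented by the sum of all
the other generalized eigenspaces. -/
theorem isCompl_genEigenspaceAt (L : E →L[ℂ] E) (α : ℂ) :
    IsCompl (genEigenspaceAt L α) (⨆ β : ℂ, ⨆ _ : β ≠ α, genEigenspaceAt L β) := by
  refine ⟨Module.End.independent_maxGenEigenspace (L : E →ₗ[ℂ] E) α, ?_⟩
  rw [codisjoint_iff, eq_top_iff, ← Module.End.iSup_maxGenEigenspace_eq_top (L : E →ₗ[ℂ] E)]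
  refine iSup_le fun β => ?_
  by_cases h : β = α
  · subst h
    exact le_sup_left
  · exact le_sup_of_le_right
      (le_iSup₂_of_le (f := fun β (_ : β ≠ α) => genEigenspaceAt L β) β h le_rfl)

/-- The spectral projection of `L` at `α`: the projection onto the generalized eigenspace at `α`
along the sum of all the other generalized eigenspaces. -/
def spectralProjection (L : E →L[ℂ] E) (α : ℂ) : E →L[ℂ] E :=
  LinearMap.toContinuousLinearMap
    (Submodule.projection (genEigenspaceAt L α)
      (⨆ β : ℂ, ⨆ _ : β ≠ α, genEigenspaceAt L β) (isCompl_genEigenspaceAt L α))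

open scoped Classical in
/-- The peripheral projection of `L`: the sum of the spectral projections over the (finitely many)
points of the spectrum on the imaginary axis. -/
def peripheralProjection (L : E →L[ℂ] E) : E →L[ℂ] E :=
  ∑ α ∈ (Module.End.finite_spectrum (L : E →ₗ[ℂ] E)).toFinset with α.re = 0,
    spectralProjection L α

end Spectral

section Evolution

variable {E : Type*} [NormedAddCommGroup E] [NormedSpace ℂ E]

/-- The `n`-th term of the Dyson series,
`∫_s^t du₁ ∫_s^{u₁} du₂ ⋯ ∫_s^{u_{n-1}} du_n A(u₁) A(u₂) ⋯ A(u_n)`. -/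
def dysonTerm (A : ℝ → E →L[ℂ] E) (s : ℝ) : ℕ → ℝ → E →L[ℂ] E
  | 0, _ => 1
  | n + 1, t => ∫ u in s..t, A u * dysonTerm A s n u

/-- The time-ordered exponential `T exp(∫_s^t A(u) du)`, given by the Dyson series. It is the
propagator from time `s` to time `t` generated by `A`. -/
def timeOrderedExp (A : ℝ → E →L[ℂ] E) (s t : ℝ) : E →L[ℂ] E :=
  ∑' n : ℕ, dysonTerm A s n t

end Evolution

section Average

variable {E : Type*} [NormedAddCommGroup E] [NormedSpace ℂ E] [FiniteDimensional ℂ E]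

/-- The finite-time average
`D̄(t,τ) = τ⁻¹ ∫_0^τ e^{-sL₀} P_φ D(t,s) P_φ e^{sL₀} ds`,
with `P_φ` the peripheral projection of `L₀`. -/
def rotatingAverage (L₀ : E →L[ℂ] E) (D : ℝ → ℝ → E →L[ℂ] E) (τ t : ℝ) : E →L[ℂ] E :=
  τ⁻¹ • ∫ s in (0 : ℝ)..τ,
    NormedSpace.exp ((-s) • L₀) * peripheralProjection L₀ * D t s *
      peripheralProjection L₀ * NormedSpace.exp (s • L₀)

end Average

end

/-! ### Spectral consequences of contractivity. -/

section SpectralBounds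

variable {E : Type*} [NormedAddCommGroup E] [NormedSpace ℂ E] [FiniteDimensional ℂ E]

/-! Let `P` be the peripheral projection. Contractivity excludes eigenvalues with positive real part
and Jordan blocks on the imaginary axis. Hence `e^{tL}P` is bounded for all real `t`, while
`e^{tL}(1 - P)` decays exponentially for `t ≥ 0`. Let `U` be the propagator of `κL + d` and `V` that
of the average `m`.

Transverse part: by Duhamel, `(1 - P)U` differs from `e^{κtL}(1 - P)` by a convolution with a kernel
of size `e^{-ηκ(t-u)}`, hence by `O(κ⁻¹)` (`norm_transverse_sub_le`).

Slow part: `W = e^{-κtL}PU` solves `W' = BW` plus a forcing by `(1 - P)U`, where `B` is the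
compressed generator in the rotating frame. `B` oscillates and need not be close to `m`, but `G =
∫(B - m)` is uniformly small. Writing `(B - m)PV = (G PV)' - G m PV` brings in only `G`, and
Grönwall gives `W ≈ PV` (`norm_rotating_sub_slow_le`).

Smallness of `G` (`tendstoUniformlyOn_integral_diagonal`): `F(u, κu)` is, up to a drift, the
derivative of `κ⁻¹∫_0^{κu} F(u,s) ds`. Convergence of the averages controls the boundary term, and
convergence of their `t`-derivatives controls the drift. -/

theorem linearMap_ext_genEigenspaceAt {F : Type*} [AddCommGroup F] [Module ℂ F]
    (L : E →L[ℂ] E) {f g : E →ₗ[ℂ] F}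
    (h : ∀ β, ∀ x ∈ genEigenspaceAt L β, f x = g x) : f = g := by
  have : (⊤ : Submodule ℂ E) ≤ LinearMap.eqLocus f g := by
    rw [← Module.End.iSup_maxGenEigenspace_eq_top (L : E →ₗ[ℂ] E)]
    exact iSup_le fun β x hx => h β x hx
  exact LinearMap.ext fun x => this trivial

theorem spectralProjection_apply_same (L : E →L[ℂ] E) {α : ℂ} {x : E}
    (hx : x ∈ genEigenspaceAt L α) : spectralProjection L α x = x :=
  Submodule.projection_apply_left (isCompl_genEigenspaceAt L α) ⟨x, hx⟩

theorem spectralProjection_apply_of_ne (L : E →L[ℂ] E) {α β : ℂ} (hβ : β ≠ α) {x : E}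
    (hx : x ∈ genEigenspaceAt L β) : spectralProjection L α x = 0 :=
  Submodule.projection_apply_of_mem_right (isCompl_genEigenspaceAt L α)
    ((le_iSup₂_of_le (f := fun β (_ : β ≠ α) => genEigenspaceAt L β) β hβ le_rfl) hx)

theorem genEigenspaceAt_eq_bot (L : E →L[ℂ] E) {β : ℂ}
    (hβ : β ∉ spectrum ℂ (L : E →ₗ[ℂ] E)) {x : E} (hx : x ∈ genEigenspaceAt L β) : x = 0 := by
  rw [← Module.End.hasEigenvalue_iff_mem_spectrum] at hβ
  by_contra h0
  obtain ⟨n, hn⟩ := Module.End.mem_maxGenEigenspace _ _ _ |>.1 hx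
  refine hβ (Module.End.hasEigenvalue_of_hasGenEigenvalue (k := n) ?_)
  intro hbot
  exact h0 ((Submodule.mem_bot ℂ).1 (hbot ▸ (Module.End.mem_genEigenspace_nat.2 hn)))

open scoped Classical in
theorem peripheralProjection_apply (L : E →L[ℂ] E) {β : ℂ} {x : E}
    (hx : x ∈ genEigenspaceAt L β) :
    peripheralProjection L x = if β.re = 0 then x else 0 := by
  by_cases hβ : β ∈ spectrum ℂ (L : E →ₗ[ℂ] E)
  · rw [peripheralProjection, sum_apply]
    split_ifs with hre
    · rw [Finset.sum_eq_single β, spectralProjection_apply_same L hx]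
      · intro α _ hne
        exact spectralProjection_apply_of_ne L hne.symm hx
      · intro h
        exact absurd (by simpa using ⟨hβ, hre⟩) h
    · refine Finset.sum_eq_zero fun α hα => spectralProjection_apply_of_ne L ?_ hx
      rintro rfl
      exact hre (Finset.mem_filter.1 hα).2
  · simp [genEigenspaceAt_eq_bot L hβ hx]

theorem peripheralProjection_mul_self (L : E →L[ℂ] E) :
    peripheralProjection L * peripheralProjection L = peripheralProjection L := by
  refine ContinuousLinearMap.coe_injective (linearMap_ext_genEigenspaceAt L fun β x hx => ?_)
  have := peripheralProjection_apply L hx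
  simp only [ContinuousLinearMap.coe_coe, mul_apply_eq_comp]
  rw [this]
  split_ifs with h
  · simpa [h] using this
  · simp

theorem commute_peripheralProjection (L : E →L[ℂ] E) : Commute L (peripheralProjection L) := by
  refine ContinuousLinearMap.coe_injective (linearMap_ext_genEigenspaceAt L fun β x hx => ?_)
  have hLx : L x ∈ genEigenspaceAt L β :=
    Module.End.mapsTo_maxGenEigenspace_of_comm (Commute.refl (L : E →ₗ[ℂ] E)) β hx
  simp only [ContinuousLinearMap.coe_coe, mul_apply_eq_comp]
  rw [peripheralProjection_apply L hx, peripheralProjection_apply L hLx]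
  split_ifs <;> simp

/-- On vectors annihilated by a power of `L - β`, the semigroup is an exponential polynomial. -/
theorem exp_smul_apply_of_pow_apply_eq_zero (L : E →L[ℂ] E) (β : ℂ) {n : ℕ} {x : E}
    (hx : ((L - β • (1 : E →L[ℂ] E)) ^ n) x = 0) (t : ℝ) :
    NormedSpace.exp (t • L) x = Complex.exp (t * β) •
      ∑ k ∈ Finset.range n, ((k.factorial : ℝ)⁻¹ * t ^ k) •
        ((L - β • (1 : E →L[ℂ] E)) ^ k) x := by
  have : CompleteSpace E := FiniteDimensional.complete ℂ E
  let _ : NormedAlgebra ℚ (E →L[ℂ] E) := NormedAlgebra.restrictScalars ℚ ℂ _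
  set N := L - β • (1 : E →L[ℂ] E) with hN
  have h1 : t • L = (algebraMap ℂ (E →L[ℂ] E)) (t * β) + t • N := by
    rw [hN, Algebra.algebraMap_eq_smul_one, mul_smul, smul_sub, Complex.coe_smul]
    abel
  have h2 : NormedSpace.exp (t • L) = Complex.exp (t * β) • NormedSpace.exp (t • N) := by
    rw [h1, NormedSpace.exp_add_of_commute (Algebra.commutes _ _),
      ← NormedSpace.algebraMap_exp_comm, ← Complex.exp_eq_exp_ℂ,
      Algebra.algebraMap_eq_smul_one, smul_mul_assoc, one_mul]
  have h3 : NormedSpace.exp (t • N) x = ∑ k ∈ Finset.range n,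
      ((k.factorial : ℝ)⁻¹ * t ^ k) • (N ^ k) x := by
    have hs := NormedSpace.exp_series_hasSum_exp' (𝕂 := ℝ) (t • N)
    have hs' := hs.mapL ((ContinuousLinearMap.apply ℂ E x).restrictScalars ℝ)
    rw [show NormedSpace.exp (t • N) x = _ from hs'.tsum_eq.symm, tsum_eq_sum (s := Finset.range n)]
    · refine Finset.sum_congr rfl fun k _ => ?_
      simp [smul_pow, smul_smul]
    · intro k hk
      have hk' : n ≤ k := by simpa using hk
      obtain ⟨m, rfl⟩ := Nat.exists_eq_add_of_le hk'
      simp [smul_pow, add_comm n m, pow_add, hx]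
  rw [h2, smul_apply, h3]

omit [FiniteDimensional ℂ E] in
theorem exists_pow_apply_eq_zero (L : E →L[ℂ] E) {β : ℂ} {x : E}
    (hx : x ∈ genEigenspaceAt L β) : ∃ n : ℕ, ((L - β • (1 : E →L[ℂ] E)) ^ n) x = 0 := by
  obtain ⟨n, hn⟩ := (Module.End.mem_maxGenEigenspace _ _ _).1 hx
  refine ⟨n, ?_⟩
  rw [← hn]
  have : (((L - β • (1 : E →L[ℂ] E)) : E →L[ℂ] E) : E →ₗ[ℂ] E) = (L : E →ₗ[ℂ] E) - β • 1 := rfl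
  rw [← this, ← ContinuousLinearMap.coe_coe, ContinuousLinearMap.toLinearMap_pow]

/-- The last nonzero vector of the chain `(L - β)^n x` would be an eigenvector that `e^{L}`
stretches by `e^{Re β} > 1`; time `1` already gives the contradiction. -/
theorem genEigenspaceAt_eq_zero_of_re_pos {L : E →L[ℂ] E} (hL : GeneratesContractionSemigroup L)
    {β : ℂ} (hβ : 0 < β.re) {x : E} (hx : x ∈ genEigenspaceAt L β) : x = 0 := by
  obtain ⟨n, hn⟩ := exists_pow_apply_eq_zero L hx
  induction n with
  | zero => simpa using hn
  | succ n ih =>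
    refine ih ?_
    set y := ((L - β • (1 : E →L[ℂ] E)) ^ n) x with hy
    have hy1 : ((L - β • (1 : E →L[ℂ] E)) ^ 1) y = 0 := by
      rw [hy, ← mul_apply_eq_comp, ← pow_add, add_comm]; exact hn
    have h := exp_smul_apply_of_pow_apply_eq_zero L β hy1 1
    have h2 := (NormedSpace.exp ((1 : ℝ) • L)).le_of_opNorm_le (hL 1 zero_le_one) y
    rw [h] at h2
    simp [norm_smul, Complex.norm_exp] at h2
    by_contra h0
    have h3 : 0 < ‖y‖ := norm_pos_iff.2 h0
    nlinarith [Real.add_one_lt_exp hβ.ne']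

/-- Imaginary eigenvalues are semisimple: a Jordan chain of length two would make the semigroup grow
linearly. Longer chains are shortened one step at a time. -/
theorem apply_eq_smul_of_re_eq_zero {L : E →L[ℂ] E} (hL : GeneratesContractionSemigroup L)
    {β : ℂ} (hβ : β.re = 0) {x : E} (hx : x ∈ genEigenspaceAt L β) :
    ((L - β • (1 : E →L[ℂ] E)) ^ 1) x = 0 := by
  obtain ⟨n, hn⟩ := exists_pow_apply_eq_zero L hx
  have key : ∀ n : ℕ, ((L - β • (1 : E →L[ℂ] E)) ^ (n + 1)) x = 0 →
      ((L - β • (1 : E →L[ℂ] E)) ^ 1) x = 0 := by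
    intro n
    induction n with
    | zero => exact id
    | succ n ih =>
      intro h
      refine ih ?_
      set y := ((L - β • (1 : E →L[ℂ] E)) ^ n) x with hy
      have hy2 : ((L - β • (1 : E →L[ℂ] E)) ^ 2) y = 0 := by
        rw [hy, ← mul_apply_eq_comp, ← pow_add, add_comm]; exact h
      have hy1 : ((L - β • (1 : E →L[ℂ] E)) ^ (n + 1)) x = (L - β • (1 : E →L[ℂ] E)) y := by
        rw [hy, pow_succ']; rfl
      rw [hy1]
      set z := (L - β • (1 : E →L[ℂ] E)) y with hz
      -- Here `e^{tL}y` is `y + t z` up to a phase, so contractivity bounds `t‖z‖` for all `t ≥ 0`.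
      have hb : ∀ t : ℝ, 0 ≤ t → t * ‖z‖ ≤ 2 * ‖y‖ := by
        intro t ht
        have h2 := (NormedSpace.exp (t • L)).le_of_opNorm_le (hL t ht) y
        rw [exp_smul_apply_of_pow_apply_eq_zero L β hy2 t, norm_smul, Complex.norm_exp] at h2
        simp only [Finset.sum_range_succ, Finset.range_zero, Finset.sum_empty, pow_zero, pow_one,
          ← hz] at h2
        simp [hβ] at h2
        have h3 : ‖t • z‖ ≤ ‖y + t • z‖ + ‖y‖ := by
          simpa using norm_sub_le (y + t • z) y
        rw [norm_smul, Real.norm_of_nonneg ht] at h3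
        linarith
      by_contra h0
      have h3 : 0 < ‖z‖ := norm_pos_iff.2 h0
      have h4 := hb ((2 * ‖y‖ + 1) / ‖z‖) (by positivity)
      rw [div_mul_cancel₀ _ h3.ne'] at h4
      linarith
  refine key n ?_
  rw [pow_succ']
  simp [hn]

/-- By uniform boundedness a pointwise bound suffices; it is checked on each generalized eigenspace
and passes to sums. On a peripheral one the semigroup acts by a phase, for negative times as well.
-/
theorem exists_norm_exp_mul_peripheralProjection_le {L : E →L[ℂ] E}
    (hL : GeneratesContractionSemigroup L) :
    ∃ M : ℝ, ∀ t : ℝ, ‖NormedSpace.exp (t • L) * peripheralProjection L‖ ≤ M := by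
  have : CompleteSpace E := FiniteDimensional.complete ℂ E
  refine banach_steinhaus fun x => ?_
  have hx : x ∈ ⨆ β, genEigenspaceAt L β := by
    have : (⨆ β, genEigenspaceAt L β) = ⊤ := Module.End.iSup_maxGenEigenspace_eq_top (L : E →ₗ[ℂ] E)
    rw [this]; trivial
  induction hx using Submodule.iSup_induction' with
  | mem β x hx =>
    by_cases hre : β.re = 0
    · refine ⟨‖x‖, fun t => ?_⟩
      rw [mul_apply_eq_comp, peripheralProjection_apply L hx, if_pos hre,
        exp_smul_apply_of_pow_apply_eq_zero L β (apply_eq_smul_of_re_eq_zero hL hre hx) t]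
      simp [norm_smul, Complex.norm_exp, hre]
    · refine ⟨0, fun t => ?_⟩
      rw [mul_apply_eq_comp, peripheralProjection_apply L hx, if_neg hre]
      simp
  | zero => exact ⟨0, fun t => by simp⟩
  | add x y _ _ hx hy =>
    obtain ⟨a, ha⟩ := hx
    obtain ⟨b, hb⟩ := hy
    exact ⟨a + b, fun t => by rw [map_add]; exact norm_add_le_of_le (ha t) (hb t)⟩

/-- The factor `2` spends one half of the gap on the polynomial factors of Jordan blocks and keeps
the other half as decay rate. -/
theorem exists_spectral_gap {s : Set ℂ} (hs : s.Finite) :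
    ∃ η : ℝ, 0 < η ∧ ∀ β ∈ s, β.re < 0 → β.re ≤ -(2 * η) := by
  induction s, hs using Set.Finite.induction_on with
  | empty => exact ⟨1, one_pos, by simp⟩
  | @insert a s _ _ ih =>
    obtain ⟨η, hη, h⟩ := ih
    by_cases ha : a.re < 0
    · refine ⟨min η (-a.re / 2), lt_min hη (by linarith), ?_⟩
      rintro β (rfl | hβ) hre
      · linarith [min_le_right η (-β.re / 2)]
      · linarith [min_le_left η (-a.re / 2), h β hβ hre]
    · refine ⟨η, hη, ?_⟩
      rintro β (rfl | hβ) hre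
      · exact absurd hre ha
      · exact h β hβ hre

theorem exists_norm_exp_mul_one_sub_peripheralProjection_le {L : E →L[ℂ] E}
    (hL : GeneratesContractionSemigroup L) :
    ∃ η > 0, ∃ M : ℝ, ∀ t : ℝ, 0 ≤ t →
      ‖NormedSpace.exp (t • L) * (1 - peripheralProjection L)‖ ≤ M * Real.exp (-(η * t)) := by
  have : CompleteSpace E := FiniteDimensional.complete ℂ E
  obtain ⟨η, hη, hgap⟩ := exists_spectral_gap (Module.End.finite_spectrum (L : E →ₗ[ℂ] E))
  refine ⟨η, hη, ?_⟩
  -- Multiplying by `e^{ηt}` turns exponential decay into plain boundedness, to which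
  -- Banach–Steinhaus applies.
  suffices h : ∃ M, ∀ t : Ici (0 : ℝ), ‖Real.exp (η * t) •
      (NormedSpace.exp ((t : ℝ) • L) * (1 - peripheralProjection L))‖ ≤ M by
    obtain ⟨M, hM⟩ := h
    refine ⟨M, fun t ht => ?_⟩
    have := hM ⟨t, ht⟩
    rw [norm_smul, Real.norm_of_nonneg (Real.exp_pos _).le] at this
    rw [Real.exp_neg, ← div_eq_mul_inv, le_div_iff₀ (Real.exp_pos _), mul_comm]
    exact this
  refine banach_steinhaus fun x => ?_
  have hx : x ∈ ⨆ β, genEigenspaceAt L β := by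
    have : (⨆ β, genEigenspaceAt L β) = ⊤ := Module.End.iSup_maxGenEigenspace_eq_top (L : E →ₗ[ℂ] E)
    rw [this]; trivial
  induction hx using Submodule.iSup_induction' with
  | mem β x hx =>
    have hzero : x = 0 ∨ β.re = 0 → ∃ C, ∀ t : Ici (0 : ℝ), ‖(Real.exp (η * t) •
        (NormedSpace.exp ((t : ℝ) • L) * (1 - peripheralProjection L))) x‖ ≤ C := by
      intro h
      refine ⟨0, fun t => ?_⟩
      rw [smul_apply, mul_apply_eq_comp,
        sub_apply, peripheralProjection_apply L hx]
      rcases h with h | h <;> simp [h]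
    by_cases hre : β.re = 0
    · exact hzero (.inr hre)
    by_cases hpos : 0 < β.re
    · exact hzero (.inl (genEigenspaceAt_eq_zero_of_re_pos hL hpos hx))
    by_cases hmem : β ∈ spectrum ℂ (L : E →ₗ[ℂ] E)
    swap
    · exact hzero (.inl (genEigenspaceAt_eq_bot L hmem hx))
    have hneg := hgap β hmem (lt_of_le_of_ne (not_lt.1 hpos) hre)
    obtain ⟨n, hn⟩ := exists_pow_apply_eq_zero L hx
    refine ⟨∑ k ∈ Finset.range n, (η ^ k)⁻¹ * ‖((L - β • (1 : E →L[ℂ] E)) ^ k) x‖, fun t => ?_⟩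
    obtain ⟨t, ht⟩ := t
    have ht : 0 ≤ t := ht
    rw [smul_apply, mul_apply_eq_comp,
        sub_apply, peripheralProjection_apply L hx, if_neg hre, sub_zero,
        one_apply_eq_self, exp_smul_apply_of_pow_apply_eq_zero L β hn t,
        norm_smul, norm_smul, ← mul_assoc, Complex.norm_exp, Real.norm_of_nonneg (Real.exp_pos _).le,
        ← Real.exp_add]
    have h1 : Real.exp (η * t + ((t : ℂ) * β).re) ≤ Real.exp (-(η * t)) := by
      refine Real.exp_le_exp.2 ?_
      rw [Complex.re_ofReal_mul]
      nlinarith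
    refine (mul_le_mul h1 (norm_sum_le _ _) (norm_nonneg _) (Real.exp_pos _).le).trans ?_
    rw [Finset.mul_sum]
    refine Finset.sum_le_sum fun k _ => ?_
    rw [norm_smul, ← mul_assoc]
    refine mul_le_mul_of_nonneg_right ?_ (norm_nonneg _)
    -- After the weight, `e^{-ηt}` remains; it absorbs `t^k / k! ≤ η^{-k} e^{ηt}`.
    have h2 := Real.pow_div_factorial_le_exp (η * t) (by positivity) k
    rw [Real.norm_of_nonneg (by positivity), Real.exp_neg, inv_mul_le_iff₀ (Real.exp_pos _),
      ← div_eq_mul_inv, le_div_iff₀ (by positivity)]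
    calc _ = (η * t) ^ k / k.factorial := by rw [mul_pow]; field_simp
      _ ≤ _ := h2
  | zero => exact ⟨0, fun t => by simp⟩
  | add x y _ _ hx hy =>
    obtain ⟨a, ha⟩ := hx
    obtain ⟨b, hb⟩ := hy
    exact ⟨a + b, fun t => by rw [map_add]; exact norm_add_le_of_le (ha t) (hb t)⟩

end SpectralBounds

/-! ### The Dyson series as solution of the evolution equation. -/

section Dyson

variable {E : Type*} [NormedAddCommGroup E] [NormedSpace ℂ E]

theorem dysonTerm_congr {A B : ℝ → E →L[ℂ] E} {T : ℝ} (h : ∀ t ∈ Icc 0 T, A t = B t) (n : ℕ) :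
    ∀ t ∈ Icc 0 T, dysonTerm A 0 n t = dysonTerm B 0 n t := by
  induction n with
  | zero => intro t _; rfl
  | succ n ih =>
    intro t ht
    refine intervalIntegral.integral_congr fun u hu => ?_
    rw [uIcc_of_le ht.1] at hu
    have hu' : u ∈ Icc 0 T := ⟨hu.1, hu.2.trans ht.2⟩
    simp only [h u hu', ih u hu']

/-- Allows a generator known only on `[0, T]` to be replaced by a continuous bounded one on the
line. -/
theorem timeOrderedExp_congr {A B : ℝ → E →L[ℂ] E} {T : ℝ} (h : ∀ t ∈ Icc 0 T, A t = B t)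
    {t : ℝ} (ht : t ∈ Icc 0 T) : timeOrderedExp A 0 t = timeOrderedExp B 0 t :=
  tsum_congr fun n => dysonTerm_congr h n t ht

theorem dysonTerm_zero_right (A : ℝ → E →L[ℂ] E) (n : ℕ) : dysonTerm A 0 (n + 1) 0 = 0 :=
  intervalIntegral.integral_same

theorem timeOrderedExp_zero (A : ℝ → E →L[ℂ] E) : timeOrderedExp A 0 0 = 1 := by
  rw [timeOrderedExp, tsum_eq_single 0]
  · rfl
  · intro n hn
    obtain ⟨m, rfl⟩ := Nat.exists_eq_succ_of_ne_zero hn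
    exact dysonTerm_zero_right A m

variable [CompleteSpace E]

theorem hasDerivAt_dysonTerm {A : ℝ → E →L[ℂ] E} (hA : Continuous A) (n : ℕ) (t : ℝ) :
    HasDerivAt (dysonTerm A 0 (n + 1)) (A t * dysonTerm A 0 n t) t := by
  have hc : Continuous (dysonTerm A 0 n) := by
    induction n with
    | zero => exact continuous_const
    | succ n ih =>
      exact intervalIntegral.continuous_primitive (fun a b => (hA.mul ih).intervalIntegrable a b) 0
  exact (hA.mul hc).integral_hasStrictDerivAt 0 t |>.hasDerivAt

omit [CompleteSpace E] in
theorem norm_dysonTerm_le {A : ℝ → E →L[ℂ] E} {M : ℝ}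
    (hM : ∀ t, ‖A t‖ ≤ M) (n : ℕ) (t : ℝ) :
    ‖dysonTerm A 0 n t‖ ≤ (M * |t|) ^ n / n.factorial := by
  induction n generalizing t with
  | zero => simpa [dysonTerm] using! ContinuousLinearMap.norm_id_le
  | succ n ih =>
    have hM0 : 0 ≤ M := (norm_nonneg _).trans (hM 0)
    have h1 : ∀ u, ‖A u * dysonTerm A 0 n u‖ ≤ M ^ (n + 1) / n.factorial * |u - 0| ^ n := by
      intro u
      refine (norm_mul_le _ _).trans ((mul_le_mul (hM u) (ih u) (norm_nonneg _) hM0).trans_eq ?_)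
      rw [sub_zero, mul_pow]; ring
    calc ‖dysonTerm A 0 (n + 1) t‖
        ≤ |∫ u in (0 : ℝ)..t, M ^ (n + 1) / n.factorial * |u - 0| ^ n| :=
          intervalIntegral.norm_integral_le_abs_of_norm_le (MeasureTheory.ae_of_all _ h1)
            (Continuous.intervalIntegrable (by fun_prop) _ _)
      _ = M ^ (n + 1) / n.factorial * (|t| ^ (n + 1) / (n + 1)) := by
          rw [intervalIntegral.abs_integral_eq_abs_integral_uIoc, MeasureTheory.integral_const_mul,
            integral_pow_abs_sub_uIoc, sub_zero, abs_of_nonneg (by positivity)]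
      _ = _ := by
          rw [mul_pow, Nat.factorial_succ]; push_cast; field_simp

theorem hasDerivAt_timeOrderedExp {A : ℝ → E →L[ℂ] E} (hA : Continuous A) {M : ℝ}
    (hM : ∀ t, ‖A t‖ ≤ M) (t : ℝ) :
    HasDerivAt (timeOrderedExp A 0) (A t * timeOrderedExp A 0 t) t := by
  have hM0 : 0 ≤ M := (norm_nonneg _).trans (hM 0)
  have hsum : ∀ t, Summable fun n => dysonTerm A 0 n t := fun t =>
    .of_norm_bounded (Real.summable_pow_div_factorial _) fun n => norm_dysonTerm_le hM n t
  have heq : timeOrderedExp A 0 = fun t => 1 + ∑' n, dysonTerm A 0 (n + 1) t := by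
    funext t
    exact (hsum t).tsum_eq_zero_add
  -- The ball must contain both `t` and the base point `0`, where convergence of the series is
  -- trivial.
  set R := |t| + 1 with hR
  have hbd : ∀ n : ℕ, ∀ y ∈ Metric.ball (0 : ℝ) R,
      ‖A y * dysonTerm A 0 n y‖ ≤ M * ((M * R) ^ n / n.factorial) := by
    intro n y hy
    have hy' : |y| ≤ R := (mem_ball_zero_iff.1 hy).le
    refine (norm_mul_le _ _).trans (mul_le_mul (hM y) ?_ (norm_nonneg _) hM0)
    refine (norm_dysonTerm_le hM n y).trans ?_
    gcongr
  have hu : Summable fun n : ℕ => M * ((M * R) ^ n / n.factorial) :=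
    (Real.summable_pow_div_factorial _).mul_left M
  have h0 : (0 : ℝ) ∈ Metric.ball (0 : ℝ) R := Metric.mem_ball_self (by positivity)
  have ht : t ∈ Metric.ball (0 : ℝ) R := by
    rw [mem_ball_zero_iff]; exact lt_add_one _
  have hs0 : Summable fun n => dysonTerm A 0 (n + 1) 0 := by
    simpa only [dysonTerm_zero_right] using summable_zero
  have hder : HasDerivAt (fun t => ∑' n, dysonTerm A 0 (n + 1) t)
      (∑' n, A t * dysonTerm A 0 n t) t :=
    hasDerivAt_tsum_of_isPreconnected (g := fun n y => dysonTerm A 0 (n + 1) y)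
      (g' := fun n y => A y * dysonTerm A 0 n y) hu Metric.isOpen_ball
      (convex_ball _ _).isPreconnected (fun n y _ => hasDerivAt_dysonTerm hA n y) hbd h0 hs0 ht
  rw [(hsum t).tsum_mul_left] at hder
  exact (hder.const_add 1).congr_of_eventuallyEq (.of_forall fun y => congrFun heq y)

end Dyson

/-! ### Averaging along the diagonal `(u, κu)`. -/

section Averaging

variable {X : Type*} [NormedAddCommGroup X] [NormedSpace ℝ X] [CompleteSpace X]

omit [CompleteSpace X] in
theorem hasDerivAt_integral_param {F F₁ : ℝ → ℝ → X} (hF : Continuous ↿F) (hF₁ : Continuous ↿F₁)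
    (hd : ∀ t s, HasDerivAt (fun r => F r s) (F₁ t s) t) (τ t : ℝ) :
    HasDerivAt (fun r => ∫ s in (0 : ℝ)..τ, F r s) (∫ s in (0 : ℝ)..τ, F₁ t s) t := by
  have hcF : ∀ r, Continuous (F r) := fun r => hF.comp (by fun_prop : Continuous fun s => (r, s))
  have hcF₁ : ∀ r, Continuous (F₁ r) := fun r => hF₁.comp (by fun_prop : Continuous fun s => (r, s))
  obtain ⟨C, hC⟩ := ((isCompact_Icc (a := t - 1) (b := t + 1)).prod
    (isCompact_uIcc (a := (0 : ℝ)) (b := τ))).exists_bound_of_continuousOn hF₁.continuousOn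
  refine (intervalIntegral.hasDerivAt_integral_of_dominated_loc_of_deriv_le (bound := fun _ => C)
    (Icc_mem_nhds (by linarith : t - 1 < t) (by linarith : t < t + 1))
    (.of_forall fun r => (hcF r).aestronglyMeasurable) ((hcF t).intervalIntegrable _ _)
    (hcF₁ t).aestronglyMeasurable (.of_forall fun s hs r hr => ?_)
    intervalIntegrable_const (.of_forall fun s _ r _ => hd r s)).2
  exact hC (r, s) ⟨hr, uIoc_subset_uIcc hs⟩

omit [CompleteSpace X] in
theorem continuous_integral_param {F : ℝ → ℝ → X} (hF : Continuous ↿F) :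
    Continuous fun p : ℝ × ℝ => ∫ s in (0 : ℝ)..p.2, F p.1 s :=
  intervalIntegral.continuous_parametric_intervalIntegral_of_continuous
    (f := fun (p : ℝ × ℝ) s => F p.1 s)
    (hF.comp (by fun_prop : Continuous fun q : (ℝ × ℝ) × ℝ => (q.1.1, q.2))) continuous_snd

/-- Chain rule along `r ↦ (r, κr)`: both partial derivatives of `(t, τ) ↦ ∫_0^τ F(t,s) ds` are
jointly continuous, so this function is strictly differentiable. -/
theorem hasDerivAt_integral_diagonal {F F₁ : ℝ → ℝ → X} (hF : Continuous ↿F)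
    (hF₁ : Continuous ↿F₁) (hd : ∀ t s, HasDerivAt (fun r => F r s) (F₁ t s) t) (κ u : ℝ) :
    HasDerivAt (fun r => ∫ s in (0 : ℝ)..κ * r, F r s)
      ((∫ s in (0 : ℝ)..κ * u, F₁ u s) + κ • F u (κ * u)) u := by
  have hcF : ∀ r, Continuous (F r) := fun r => hF.comp (by fun_prop : Continuous fun s => (r, s))
  have hc₁ := continuous_integral_param hF₁
  have hst := hasStrictFDerivAt_uncurry_coprod (𝕜 := ℝ) (u := (u, κ * u))
    (f := fun t τ => ∫ s in (0 : ℝ)..τ, F t s)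
    (f₁ := fun t τ => ContinuousLinearMap.toSpanSingleton ℝ (∫ s in (0 : ℝ)..τ, F₁ t s))
    (f₂ := fun t τ => ContinuousLinearMap.toSpanSingleton ℝ (F t τ))
    (.of_forall fun p => (hasDerivAt_integral_param hF hF₁ hd p.2 p.1).hasFDerivAt)
    (.of_forall fun p => ((hcF p.1).integral_hasStrictDerivAt 0 p.2).hasDerivAt.hasFDerivAt)
    ((ContinuousLinearMap.toSpanSingletonCLE (𝕜 := ℝ) (E := X)).continuous.comp hc₁).continuousAt
    ((ContinuousLinearMap.toSpanSingletonCLE (𝕜 := ℝ) (E := X)).continuous.comp hF).continuousAt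
  have hcurve : HasDerivAt (fun r : ℝ => (r, κ * r)) (1, κ) u := by
    simpa using (hasDerivAt_id u).prodMk ((hasDerivAt_id u).const_mul κ)
  have := hst.hasFDerivAt.comp_hasDerivAt u hcurve
  refine (show HasDerivAt (fun r => ∫ s in (0 : ℝ)..κ * r, F r s) _ u from this).congr_deriv ?_
  simp [Function.HasUncurry.uncurry]

omit [CompleteSpace X] in
/-- Uniform convergence of the averages of `F` to `m` gives a sublinear bound on the fluctuation
of the integrals. -/
theorem exists_norm_integral_sub_smul_le {F : ℝ → ℝ → X} {m : ℝ → X} {T : ℝ}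
    (hF : Continuous ↿F) (hm : ContinuousOn m (Icc 0 T))
    (h : TendstoUniformlyOn (fun τ t => τ⁻¹ • ∫ s in (0 : ℝ)..τ, F t s) m atTop (Icc 0 T))
    {ε : ℝ} (hε : 0 < ε) :
    ∃ C, ∀ t ∈ Icc 0 T, ∀ τ, 0 ≤ τ → ‖(∫ s in (0 : ℝ)..τ, F t s) - τ • m t‖ ≤ C + ε * τ := by
  obtain ⟨R, hR⟩ := eventually_atTop.1 (Metric.tendstoUniformlyOn_iff.1 h ε hε)
  -- Compactness covers the `τ` to which the limit says nothing; `max R 1` keeps `τ` positive beyond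
  -- them, so that `τ⁻¹` can be cancelled.
  have hc : ContinuousOn (fun p : ℝ × ℝ => (∫ s in (0 : ℝ)..p.2, F p.1 s) - p.2 • m p.1)
      (Icc 0 T ×ˢ Icc 0 (max R 1)) :=
    (continuous_integral_param hF).continuousOn.sub
      (continuousOn_snd.smul (hm.comp continuousOn_fst fun p hp => hp.1))
  obtain ⟨C, hC⟩ := (isCompact_Icc.prod isCompact_Icc).exists_bound_of_continuousOn hc
  refine ⟨max C 0, fun t ht τ hτ => ?_⟩
  rcases le_total τ (max R 1) with hle | hle
  · exact (hC (t, τ) ⟨ht, hτ, hle⟩).trans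
      ((le_max_left _ _).trans (le_add_of_nonneg_right (by positivity)))
  · have hτ0 : 0 < τ := lt_of_lt_of_le one_pos ((le_max_right _ _).trans hle)
    have h1 := hR τ ((le_max_left _ _).trans hle) t ht
    rw [dist_comm, dist_eq_norm] at h1
    have h2 : (∫ s in (0 : ℝ)..τ, F t s) - τ • m t
        = τ • (τ⁻¹ • (∫ s in (0 : ℝ)..τ, F t s) - m t) := by
      rw [smul_sub, smul_inv_smul₀ hτ0.ne']
    rw [h2, norm_smul, Real.norm_of_nonneg hτ, mul_comm]
    exact (mul_le_mul_of_nonneg_right h1.le hτ).trans (le_add_of_nonneg_left (le_max_right _ _))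

/-- Fundamental theorem of calculus for `κ⁻¹(∫_0^{κu} F(u,s) ds - κu m(u))`. Both terms on the right
are fluctuations as in `exists_norm_integral_sub_smul_le`, for `F` and for its `t`-derivative. -/
theorem integral_diagonal_sub_eq {F F₁ : ℝ → ℝ → X} {m m' : ℝ → X} {T : ℝ}
    (hF : Continuous ↿F) (hF₁ : Continuous ↿F₁)
    (hd : ∀ t s, HasDerivAt (fun r => F r s) (F₁ t s) t)
    (hm : ContinuousOn m (Icc 0 T)) (hm' : ContinuousOn m' (Icc 0 T))
    (hmd : ∀ t ∈ Ioo 0 T, HasDerivAt m (m' t) t) {κ : ℝ} (hκ : 0 < κ) {t : ℝ}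
    (ht : t ∈ Icc 0 T) :
    ∫ u in (0 : ℝ)..t, (F u (κ * u) - m u) =
      κ⁻¹ • ((∫ s in (0 : ℝ)..κ * t, F t s) - (κ * t) • m t)
        - ∫ u in (0 : ℝ)..t, κ⁻¹ • ((∫ s in (0 : ℝ)..κ * u, F₁ u s) - (κ * u) • m' u) := by
  have hsub : Icc 0 t ⊆ Icc 0 T := Icc_subset_Icc_right ht.2
  have hcurve : Continuous fun u : ℝ => (u, κ * u) := by fun_prop
  have hFd : Continuous fun u => F u (κ * u) := hF.comp hcurve
  have hHd : Continuous fun u => ∫ s in (0 : ℝ)..κ * u, F u s :=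
    (continuous_integral_param hF).comp hcurve
  have hH₁d : Continuous fun u => ∫ s in (0 : ℝ)..κ * u, F₁ u s :=
    (continuous_integral_param hF₁).comp hcurve
  have hi₁ : ContinuousOn (fun u => F u (κ * u) - m u) (Icc 0 t) :=
    hFd.continuousOn.sub (hm.mono hsub)
  have hi₂ : ContinuousOn
      (fun u => κ⁻¹ • ((∫ s in (0 : ℝ)..κ * u, F₁ u s) - (κ * u) • m' u)) (Icc 0 t) :=
    (hH₁d.continuousOn.sub
      ((continuous_const.mul continuous_id).continuousOn.smul (hm'.mono hsub))).const_smul _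
  rw [eq_sub_iff_add_eq, ← intervalIntegral.integral_add
    (hi₁.intervalIntegrable_of_Icc ht.1) (hi₂.intervalIntegrable_of_Icc ht.1)]
  have hcont : ContinuousOn
      (fun u => κ⁻¹ • ((∫ s in (0 : ℝ)..κ * u, F u s) - (κ * u) • m u)) (Icc 0 t) :=
    (hHd.continuousOn.sub
      ((continuous_const.mul continuous_id).continuousOn.smul (hm.mono hsub))).const_smul _
  refine (intervalIntegral.integral_eq_sub_of_hasDerivAt_of_le ht.1 hcont ?_
    ((hi₁.add hi₂).intervalIntegrable_of_Icc ht.1)).trans ?_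
  · intro u hu
    have h1 := hasDerivAt_integral_diagonal hF hF₁ hd κ u
    have h2 := ((hasDerivAt_id u).const_mul κ).smul (hmd u ⟨hu.1, hu.2.trans_le ht.2⟩)
    refine ((h1.sub h2).const_smul κ⁻¹).congr_deriv ?_
    simp only [smul_sub, smul_add, mul_one, id, smul_smul, inv_mul_cancel₀ hκ.ne', one_smul,
      Pi.add_apply]
    abel
  · simp

/-- Averaging principle: if the averages of `F` and of its derivative converge uniformly, then
`F (u, κ u)` may be replaced by the average of `F` under the integral as `κ → ∞`. -/
theorem tendstoUniformlyOn_integral_diagonal {F F₁ : ℝ → ℝ → X} {m m' : ℝ → X} {T : ℝ}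
    (hT : 0 < T) (hF : Continuous ↿F) (hF₁ : Continuous ↿F₁)
    (hd : ∀ t s, HasDerivAt (fun r => F r s) (F₁ t s) t)
    (hm : ContinuousOn m (Icc 0 T)) (hm' : ContinuousOn m' (Icc 0 T))
    (hmd : ∀ t ∈ Ioo 0 T, HasDerivAt m (m' t) t)
    (h : TendstoUniformlyOn (fun τ t => τ⁻¹ • ∫ s in (0 : ℝ)..τ, F t s) m atTop (Icc 0 T))
    (h₁ : TendstoUniformlyOn (fun τ t => τ⁻¹ • ∫ s in (0 : ℝ)..τ, F₁ t s) m' atTop (Icc 0 T))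
    {ε : ℝ} (hε : 0 < ε) :
    ∀ᶠ κ in atTop, ∀ t ∈ Icc 0 T, ‖∫ u in (0 : ℝ)..t, (F u (κ * u) - m u)‖ ≤ ε := by
  -- The boundary term costs `δT` and the integrated drift `δT²`, together `ε/2`; the constants `C`,
  -- `C₁` are damped by `κ⁻¹` and take the other half.
  set δ := ε / (2 * (T + T * T)) with hδ
  have hδ0 : 0 < δ := by positivity
  obtain ⟨C, hC⟩ := exists_norm_integral_sub_smul_le hF hm h hδ0
  obtain ⟨C₁, hC₁⟩ := exists_norm_integral_sub_smul_le hF₁ hm' h₁ hδ0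
  have hlim : Tendsto (fun κ : ℝ => κ⁻¹ * (|C| + |C₁| * T)) atTop (𝓝 0) := by
    simpa using tendsto_inv_atTop_zero.mul_const (|C| + |C₁| * T)
  filter_upwards [eventually_gt_atTop 0, hlim.eventually_lt_const (half_pos hε)]
    with κ hκ hsmall t ht
  rw [integral_diagonal_sub_eq hF hF₁ hd hm hm' hmd hκ ht]
  have hκi : 0 < κ⁻¹ := inv_pos.2 hκ
  have key : ∀ {a c u : ℝ}, a ≤ c + δ * (κ * u) → u ∈ Icc 0 T →
      κ⁻¹ * a ≤ κ⁻¹ * |c| + δ * T := by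
    intro a c u ha hu
    calc κ⁻¹ * a ≤ κ⁻¹ * (|c| + δ * (κ * u)) := by
          gcongr; exact ha.trans (by gcongr; exact le_abs_self c)
      _ = κ⁻¹ * |c| + δ * u := by field_simp
      _ ≤ _ := by gcongr; exact hu.2
  have e1 : ‖κ⁻¹ • ((∫ s in (0 : ℝ)..κ * t, F t s) - (κ * t) • m t)‖ ≤ κ⁻¹ * |C| + δ * T := by
    rw [norm_smul, Real.norm_of_nonneg hκi.le]
    exact key (hC t ht _ (mul_nonneg hκ.le ht.1)) ht
  have e2 : ‖∫ u in (0 : ℝ)..t, κ⁻¹ • ((∫ s in (0 : ℝ)..κ * u, F₁ u s) - (κ * u) • m' u)‖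
      ≤ (κ⁻¹ * |C₁| + δ * T) * T := by
    have hb : ∀ u ∈ uIoc 0 t, ‖κ⁻¹ • ((∫ s in (0 : ℝ)..κ * u, F₁ u s) - (κ * u) • m' u)‖
        ≤ κ⁻¹ * |C₁| + δ * T := by
      intro u hu
      rw [uIoc_of_le ht.1] at hu
      have hu' : u ∈ Icc 0 T := ⟨hu.1.le, hu.2.trans ht.2⟩
      rw [norm_smul, Real.norm_of_nonneg hκi.le]
      exact key (hC₁ u hu' _ (mul_nonneg hκ.le hu'.1)) hu'
    refine (intervalIntegral.norm_integral_le_of_norm_le_const hb).trans ?_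
    rw [sub_zero, abs_of_nonneg ht.1]
    gcongr
    exact ht.2
  have e3 : δ * (T + T * T) = ε / 2 := by rw [hδ]; field_simp
  refine (norm_sub_le_of_le e1 e2).trans ?_
  nlinarith

end Averaging

/-! ### Grönwall's inequality and exponential kernels. -/

theorem le_mul_exp_of_le_add_integral {φ : ℝ → ℝ} {a c T : ℝ} (hφ : Continuous φ) (hc : 0 ≤ c)
    (h : ∀ t ∈ Icc 0 T, φ t ≤ a + c * ∫ u in (0 : ℝ)..t, φ u) :
    ∀ t ∈ Icc 0 T, φ t ≤ a * Real.exp (c * t) := by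
  intro t ht
  -- Integrating factor: the hypothesis says exactly that `f' ≤ 0`.
  set f : ℝ → ℝ := fun t => (a + c * ∫ u in (0 : ℝ)..t, φ u) * Real.exp (-(c * t)) with hf
  have hd : ∀ u, HasDerivAt f (c * (φ u - (a + c * ∫ v in (0 : ℝ)..u, φ v)) *
      Real.exp (-(c * u))) u := by
    intro u
    have h1 := ((hφ.integral_hasStrictDerivAt 0 u).hasDerivAt.const_mul c).const_add a
    have h2 := (((hasDerivAt_id u).const_mul c).neg).exp
    refine (h1.mul h2).congr_deriv ?_
    simp only [id, Pi.neg_apply]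
    ring
  have hanti : AntitoneOn f (Icc 0 T) := by
    refine antitoneOn_of_deriv_nonpos (convex_Icc 0 T)
      (fun u _ => (hd u).continuousAt.continuousWithinAt)
      (fun u _ => (hd u).differentiableAt.differentiableWithinAt) fun u hu => ?_
    rw [interior_Icc] at hu
    rw [(hd u).deriv]
    exact mul_nonpos_of_nonpos_of_nonneg
      (mul_nonpos_of_nonneg_of_nonpos hc (sub_nonpos.2 (h u ⟨hu.1.le, hu.2.le⟩)))
      (Real.exp_pos _).le
  have h0 := hanti ⟨le_rfl, ht.1.trans ht.2⟩ ht ht.1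
  simp only [hf, intervalIntegral.integral_same, mul_zero, neg_zero, Real.exp_zero, mul_one,
    add_zero] at h0
  rw [Real.exp_neg, ← div_eq_mul_inv, div_le_iff₀ (Real.exp_pos _)] at h0
  exact (h t ht).trans h0

/-- Used with `a = ηκ`, this is where the rate `κ⁻¹` comes from. -/
theorem integral_exp_neg_mul_le {a : ℝ} (ha : 0 < a) (t : ℝ) :
    ∫ u in (0 : ℝ)..t, Real.exp (-(a * u)) ≤ a⁻¹ := by
  have hd : ∀ u ∈ uIcc 0 t, HasDerivAt (fun u => -a⁻¹ * Real.exp (-(a * u)))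
      (Real.exp (-(a * u))) u := by
    intro u _
    refine (((((hasDerivAt_id u).const_mul a).neg).exp).const_mul (-a⁻¹)).congr_deriv ?_
    simp only [id, Pi.neg_apply]
    field_simp
  rw [intervalIntegral.integral_eq_sub_of_hasDerivAt hd
    (Continuous.intervalIntegrable (by fun_prop) _ _)]
  have : 0 < a⁻¹ * Real.exp (-(a * t)) := by positivity
  simp only [mul_zero, neg_zero, Real.exp_zero]
  linarith

theorem integral_exp_neg_mul_sub_le {a : ℝ} (ha : 0 < a) (t : ℝ) :
    ∫ u in (0 : ℝ)..t, Real.exp (-(a * (t - u))) ≤ a⁻¹ := by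
  rw [intervalIntegral.integral_comp_sub_left (fun u => Real.exp (-(a * u)))]
  simpa using integral_exp_neg_mul_le ha t

/-! ### Duhamel's formula and the rotating frame. -/

section Rotating

variable {𝔸 : Type*} [NormedRing 𝔸] [NormedAlgebra ℝ 𝔸] [CompleteSpace 𝔸]

theorem exp_smul_mul_exp_smul (L : 𝔸) (s t : ℝ) :
    NormedSpace.exp (s • L) * NormedSpace.exp (t • L) = NormedSpace.exp ((s + t) • L) := by
  let _ : NormedAlgebra ℚ 𝔸 := NormedAlgebra.restrictScalars ℚ ℝ 𝔸
  rw [add_smul, NormedSpace.exp_add_of_commute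
    (((Commute.refl L).smul_left s).smul_right t)]

theorem exp_neg_smul_mul_exp_smul (L : 𝔸) (t : ℝ) :
    NormedSpace.exp ((-t) • L) * NormedSpace.exp (t • L) = 1 := by
  rw [exp_smul_mul_exp_smul]; simp

omit [CompleteSpace 𝔸] in
theorem Commute.exp_smul_left {L R : 𝔸} (h : Commute L R) (t : ℝ) :
    Commute (NormedSpace.exp (t • L)) R := by
  let _ : NormedAlgebra ℚ 𝔸 := NormedAlgebra.restrictScalars ℚ ℝ 𝔸
  exact (h.smul_left t).exp_left

theorem continuous_exp_smul (L : 𝔸) : Continuous fun t : ℝ => NormedSpace.exp (t • L) :=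
  continuous_iff_continuousAt.2 fun t => (hasDerivAt_exp_smul_const (𝕂 := ℝ) L t).continuousAt

/-- The `κL` terms cancel because `R` commutes with `L`, leaving no term that grows with `κ`. The
choice `t = 0` is the rotating frame; a final time `t` gives Duhamel's formula. -/
theorem hasDerivAt_exp_mul_propagator {L R : 𝔸} (hR : Commute L R) {κ : ℝ} {d U : ℝ → 𝔸} {u : ℝ}
    (hU : HasDerivAt U ((κ • L + d u) * U u) u) (t : ℝ) :
    HasDerivAt (fun u => NormedSpace.exp ((κ * (t - u)) • L) * R * U u)
      (NormedSpace.exp ((κ * (t - u)) • L) * R * d u * U u) u := by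
  have h1 : HasDerivAt (fun u : ℝ => κ * (t - u)) (-κ) u := by
    simpa using ((hasDerivAt_id u).const_sub t).const_mul κ
  have h2 := (hasDerivAt_exp_smul_const (𝕂 := ℝ) L (κ * (t - u))).scomp u h1
  refine ((h2.mul_const R).mul hU).congr_deriv ?_
  simp only [Function.comp_apply, neg_smul, neg_mul, smul_mul_assoc, add_mul, mul_add,
    mul_smul_comm, mul_assoc]
  rw [← mul_assoc L R, hR.eq]
  simp only [mul_assoc]
  abel

theorem propagator_eq_add_integral {L R : 𝔸} (hR : Commute L R) {κ : ℝ} {d U : ℝ → 𝔸}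
    (hd : Continuous d) (hU : ∀ u, HasDerivAt U ((κ • L + d u) * U u) u) (hU0 : U 0 = 1) (t : ℝ) :
    R * U t - NormedSpace.exp ((κ * t) • L) * R =
      ∫ u in (0 : ℝ)..t, NormedSpace.exp ((κ * (t - u)) • L) * R * d u * U u := by
  have hUc : Continuous U := continuous_iff_continuousAt.2 fun u => (hU u).continuousAt
  have hc : Continuous fun u => NormedSpace.exp ((κ * (t - u)) • L) * R * d u * U u :=
    (((continuous_exp_smul L).comp (by fun_prop : Continuous fun u => κ * (t - u))).mul_const R
      |>.mul hd).mul hUc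
  rw [intervalIntegral.integral_eq_sub_of_hasDerivAt
    (fun u _ => hasDerivAt_exp_mul_propagator hR (hU u) t) (hc.intervalIntegrable _ _)]
  simp [hU0]

/-- Duhamel with `R = 1`, contractivity and Grönwall; the point is that the bound does not depend on
`κ`. -/
theorem norm_propagator_le {L : 𝔸} (hL : ∀ t : ℝ, 0 ≤ t → ‖NormedSpace.exp (t • L)‖ ≤ 1)
    {κ C T : ℝ} (hκ : 0 < κ) {d U : ℝ → 𝔸} (hd : Continuous d) (hC : ∀ t, ‖d t‖ ≤ C)
    (hU : ∀ u, HasDerivAt U ((κ • L + d u) * U u) u) (hU0 : U 0 = 1) :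
    ∀ t ∈ Icc 0 T, ‖U t‖ ≤ Real.exp (C * T) := by
  have hC0 : 0 ≤ C := (norm_nonneg _).trans (hC 0)
  have hUc : Continuous U := continuous_iff_continuousAt.2 fun u => (hU u).continuousAt
  intro t ht
  have := le_mul_exp_of_le_add_integral (a := 1) hUc.norm hC0 (T := T) (fun t ht => ?_) t ht
  · rw [one_mul] at this
    exact this.trans (Real.exp_le_exp.2 (mul_le_mul_of_nonneg_left ht.2 hC0))
  · have h1 := propagator_eq_add_integral (Commute.one_right L) hd hU hU0 t
    rw [one_mul, mul_one, sub_eq_iff_eq_add'] at h1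
    rw [h1, ← intervalIntegral.integral_const_mul]
    refine norm_add_le_of_le (hL _ (mul_nonneg hκ.le ht.1))
      (intervalIntegral.norm_integral_le_of_norm_le ht.1 (.of_forall fun u hu => ?_)
        ((hUc.norm.const_mul C).intervalIntegrable _ _))
    have h2 := hL (κ * (t - u)) (mul_nonneg hκ.le (sub_nonneg.2 hu.2))
    rw [mul_one]
    refine (norm_mul_le _ _).trans (mul_le_mul_of_nonneg_right ?_ (norm_nonneg _))
    calc _ ≤ 1 * C := norm_mul_le_of_le h2 (hC u)
      _ = C := one_mul C

/-- The part of the propagator transverse to the slow subspace is slaved to the free evolution. -/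
theorem norm_transverse_sub_le {L R : 𝔸} (hR : Commute L R) {M η : ℝ} (hη : 0 < η)
    (hM : ∀ t : ℝ, 0 ≤ t → ‖NormedSpace.exp (t • L) * R‖ ≤ M * Real.exp (-(η * t)))
    {κ C K T : ℝ} (hκ : 0 < κ) {d U : ℝ → 𝔸} (hd : Continuous d) (hC : ∀ t, ‖d t‖ ≤ C)
    (hU : ∀ u, HasDerivAt U ((κ • L + d u) * U u) u) (hU0 : U 0 = 1)
    (hK : ∀ t ∈ Icc 0 T, ‖U t‖ ≤ K) {t : ℝ} (ht : t ∈ Icc 0 T) :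
    ‖R * U t - NormedSpace.exp ((κ * t) • L) * R‖ ≤ M * C * K * η⁻¹ * κ⁻¹ := by
  have hC0 : 0 ≤ C := (norm_nonneg _).trans (hC 0)
  have hK0 : 0 ≤ K := (norm_nonneg _).trans (hK t ht)
  have hM0 : 0 ≤ M := by simpa using (norm_nonneg _).trans (hM 0 le_rfl)
  rw [propagator_eq_add_integral hR hd hU hU0 t]
  have hb : ∀ u ∈ Ioc 0 t, ‖NormedSpace.exp ((κ * (t - u)) • L) * R * d u * U u‖ ≤
      M * C * K * Real.exp (-(η * κ * (t - u))) := by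
    intro u hu
    have h1 := hM (κ * (t - u)) (mul_nonneg hκ.le (sub_nonneg.2 hu.2))
    calc _ ≤ M * Real.exp (-(η * (κ * (t - u)))) * C * K :=
          norm_mul_le_of_le (norm_mul_le_of_le h1 (hC u)) (hK u ⟨hu.1.le, hu.2.trans ht.2⟩)
      _ = _ := by rw [mul_assoc η]; ring
  refine (intervalIntegral.norm_integral_le_of_norm_le ht.1 (.of_forall hb)
    (Continuous.intervalIntegrable (by fun_prop) _ _)).trans ?_
  rw [intervalIntegral.integral_const_mul]
  refine (mul_le_mul_of_nonneg_left (integral_exp_neg_mul_sub_le (mul_pos hη hκ) t)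
    (by positivity)).trans_eq ?_
  rw [mul_inv]; ring

/-- The generator `d` compressed to the range of `P` and seen in the frame rotating with `L`. -/
noncomputable def rotatingGenerator (L P : 𝔸) (d : 𝔸) (s : ℝ) : 𝔸 :=
  NormedSpace.exp ((-s) • L) * P * d * P * NormedSpace.exp (s • L)

omit [CompleteSpace 𝔸] in
theorem norm_rotatingGenerator_le {L P : 𝔸} (hLP : Commute L P) {M : ℝ}
    (hM : ∀ t : ℝ, ‖NormedSpace.exp (t • L) * P‖ ≤ M) {d : 𝔸} {C : ℝ} (hC : ‖d‖ ≤ C) (s : ℝ) :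
    ‖rotatingGenerator L P d s‖ ≤ M * C * M := by
  rw [rotatingGenerator, mul_assoc _ P, ← (hLP.exp_smul_left s).eq]
  exact norm_mul_le_of_le (norm_mul_le_of_le (hM _) hC) (hM s)

theorem continuous_rotatingGenerator {L P : 𝔸} {κ : ℝ} {d : ℝ → 𝔸} (hd : Continuous d) :
    Continuous fun u => rotatingGenerator L P (d u) (κ * u) := by
  have h1 := (continuous_exp_smul L).comp (by fun_prop : Continuous fun u => -(κ * u))
  have h2 := (continuous_exp_smul L).comp (by fun_prop : Continuous fun u => κ * u)
  exact (((h1.mul_const P).mul hd).mul_const P).mul h2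

-- Since `m` takes values in `P𝔸`, the slow evolution leaves the transverse component constant.
omit [CompleteSpace 𝔸] in
theorem proj_mul_propagator_slow {P : 𝔸} {m V : ℝ → 𝔸} (hPm : ∀ t, P * m t = m t)
    (hV : ∀ u, HasDerivAt V (m u * V u) u) (hV0 : V 0 = 1) (t : ℝ) :
    (1 - P) * V t = 1 - P := by
  have hd : ∀ u, HasDerivAt (fun u => (1 - P) * V u) 0 u := by
    intro u
    refine ((hV u).const_mul (1 - P)).congr_deriv ?_
    rw [← mul_assoc, sub_mul, one_mul, hPm, sub_self, zero_mul]
  have := is_const_of_deriv_eq_zero (fun u => (hd u).differentiableAt) (fun u => (hd u).deriv) t 0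
  simpa [hV0] using this

end Rotating

/-! ### Comparison with the averaged evolution. -/

section Slow

variable {𝔸 : Type*} [NormedRing 𝔸] [NormedAlgebra ℝ 𝔸] [CompleteSpace 𝔸]

/-- In the rotating frame, the slow part of the propagator follows the averaged evolution, up to the
integrated deviation `γ` of the rotating generator from `m` and to the transverse part of `U`. -/
theorem norm_rotating_sub_slow_le {L P : 𝔸} (hLP : Commute L P) (hPP : P * P = P) {M : ℝ}
    (hM : ∀ t : ℝ, ‖NormedSpace.exp (t • L) * P‖ ≤ M) {κ C T : ℝ}
    {d U : ℝ → 𝔸} (hd : Continuous d) (hC : ∀ t, ‖d t‖ ≤ C)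
    (hU : ∀ u, HasDerivAt U ((κ • L + d u) * U u) u) (hU0 : U 0 = 1)
    {m V : ℝ → 𝔸} (hm : Continuous m) {Cm : ℝ} (hCm : ∀ t, ‖m t‖ ≤ Cm)
    (hPm : ∀ t, P * m t = m t) (hmP : ∀ t, m t * P = m t)
    (hV : ∀ u, HasDerivAt V (m u * V u) u) (hV0 : V 0 = 1)
    {K γ : ℝ} (hK : ∀ t ∈ Icc 0 T, ‖P * V t‖ ≤ K)
    (hγ : ∀ t ∈ Icc 0 T, ‖∫ u in (0 : ℝ)..t, (rotatingGenerator L P (d u) (κ * u) - m u)‖ ≤ γ)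
    {q : ℝ → ℝ} (hq : Continuous q) (hQ : ∀ t ∈ Icc 0 T, ‖(1 - P) * U t‖ ≤ q t)
    {t : ℝ} (ht : t ∈ Icc 0 T) :
    ‖NormedSpace.exp ((-(κ * t)) • L) * P * U t - P * V t‖ ≤
      (γ * K * (1 + T * Cm) + M * C * ∫ u in (0 : ℝ)..T, q u) * Real.exp (M * C * M * t) := by
  have hT0 : 0 ≤ T := ht.1.trans ht.2
  have hC0 : 0 ≤ C := (norm_nonneg _).trans (hC 0)
  have hM0 : 0 ≤ M := (norm_nonneg _).trans (hM 0)
  have hK0 : 0 ≤ K := (norm_nonneg _).trans (hK t ht)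
  have hCm0 : 0 ≤ Cm := (norm_nonneg _).trans (hCm 0)
  have hγ0 : 0 ≤ γ := (norm_nonneg _).trans (hγ t ht)
  have hUc : Continuous U := continuous_iff_continuousAt.2 fun u => (hU u).continuousAt
  have hVc : Continuous V := continuous_iff_continuousAt.2 fun u => (hV u).continuousAt
  set e : ℝ → 𝔸 := fun u => NormedSpace.exp ((-(κ * u)) • L) with he
  have hec : Continuous e := (continuous_exp_smul L).comp (by fun_prop)
  set B : ℝ → 𝔸 := fun u => rotatingGenerator L P (d u) (κ * u) with hB
  have hBc : Continuous B := continuous_rotatingGenerator hd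
  set G : ℝ → 𝔸 := fun t => ∫ u in (0 : ℝ)..t, (B u - m u) with hG
  have hGd : ∀ u, HasDerivAt G (B u - m u) u := fun u =>
    ((hBc.sub hm).integral_hasStrictDerivAt 0 u).hasDerivAt
  have hGc : Continuous G := continuous_iff_continuousAt.2 fun u => (hGd u).continuousAt
  set W : ℝ → 𝔸 := fun u => e u * P * U u with hW
  set Z : ℝ → 𝔸 := fun u => P * V u with hZ
  set Δ : ℝ → 𝔸 := fun u => W u - Z u with hΔ
  have hΔc : Continuous Δ := ((hec.mul_const P).mul hUc).sub (hVc.const_mul P)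
  have hZc : Continuous Z := hVc.const_mul P
  have hWd : ∀ u, HasDerivAt W (B u * W u + e u * P * d u * ((1 - P) * U u)) u := by
    intro u
    have h := hasDerivAt_exp_mul_propagator hLP (hU u) 0
    simp only [zero_sub, mul_neg] at h
    refine h.congr_deriv ?_
    have h1 : B u * W u = e u * P * d u * (P * U u) := by
      have h2 : NormedSpace.exp ((κ * u) • L) * e u = 1 := by
        have h := exp_neg_smul_mul_exp_smul L (-(κ * u))
        rwa [neg_neg] at h
      calc B u * W u = e u * P * d u * P * (NormedSpace.exp ((κ * u) • L) * e u) * P * U u := by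
            simp only [hB, hW, rotatingGenerator, he, mul_assoc]
        _ = e u * P * d u * (P * P) * U u := by rw [h2]; simp only [mul_assoc, one_mul]
        _ = _ := by rw [hPP]; simp only [mul_assoc]
    rw [h1, ← mul_add, ← add_mul, add_sub_cancel, one_mul]
  have hZd : ∀ u, HasDerivAt Z (m u * Z u) u := by
    intro u
    refine ((hV u).const_mul P).congr_deriv ?_
    rw [← mul_assoc, hPm, ← mul_assoc, hmP]
  -- Subtracting `G Z` trades `(B - m) Z`, which is not small, for `G m Z`, which is.
  have hd' : ∀ u, HasDerivAt (fun u => Δ u - G u * Z u)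
      (B u * Δ u + e u * P * d u * ((1 - P) * U u) - G u * (m u * Z u)) u := by
    intro u
    refine (((hWd u).sub (hZd u)).sub ((hGd u).mul (hZd u))).congr_deriv ?_
    simp only [hΔ, mul_sub, sub_mul]
    abel
  have hcont : Continuous fun u =>
      B u * Δ u + e u * P * d u * ((1 - P) * U u) - G u * (m u * Z u) :=
    ((hBc.mul hΔc).add (((hec.mul_const P).mul hd).mul (hUc.const_mul _))).sub
      (hGc.mul (hm.mul hZc))
  refine le_mul_exp_of_le_add_integral hΔc.norm (by positivity) (fun t ht => ?_) t ht
  have hint := intervalIntegral.integral_eq_sub_of_hasDerivAt (fun u _ => hd' u)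
    (hcont.intervalIntegrable 0 t)
  have h0 : Δ 0 - G 0 * Z 0 = 0 := by simp [hΔ, hG, hW, hZ, he, hU0, hV0]
  rw [h0, sub_zero, eq_comm, sub_eq_iff_eq_add'] at hint
  rw [hint]
  have hmem : ∀ u ∈ Ioc 0 t, u ∈ Icc 0 T := fun u hu => ⟨hu.1.le, hu.2.trans ht.2⟩
  have hqi : ∫ u in (0 : ℝ)..t, q u ≤ ∫ u in (0 : ℝ)..T, q u := by
    rw [← intervalIntegral.integral_add_adjacent_intervals (hq.intervalIntegrable 0 t)
      (hq.intervalIntegrable t T)]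
    exact le_add_of_nonneg_right (intervalIntegral.integral_nonneg ht.2 fun u hu =>
      (norm_nonneg _).trans (hQ u ⟨ht.1.trans hu.1, hu.2⟩))
  have hb : ∀ u ∈ Ioc 0 t,
      ‖B u * Δ u + e u * P * d u * ((1 - P) * U u) - G u * (m u * Z u)‖ ≤
        M * C * M * ‖Δ u‖ + M * C * q u + γ * (Cm * K) := by
    intro u hu
    refine norm_sub_le_of_le (norm_add_le_of_le ?_ ?_) ?_
    · exact norm_mul_le_of_le (norm_rotatingGenerator_le hLP hM (hC u) _) le_rfl
    · exact norm_mul_le_of_le (norm_mul_le_of_le (hM _) (hC u)) (hQ u (hmem u hu))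
    · exact norm_mul_le_of_le (hγ u (hmem u hu)) (norm_mul_le_of_le (hCm u) (hK u (hmem u hu)))
  have hi1 : Continuous fun u => M * C * M * ‖Δ u‖ := hΔc.norm.const_mul _
  have hi2 : Continuous fun u => M * C * q u := hq.const_mul _
  have hi3 : Continuous fun u => M * C * M * ‖Δ u‖ + M * C * q u + γ * (Cm * K) :=
    (hi1.add hi2).add continuous_const
  have hI := intervalIntegral.norm_integral_le_of_norm_le (μ := MeasureTheory.volume) ht.1
    (MeasureTheory.ae_of_all _ hb) (hi3.intervalIntegrable 0 t)
  rw [intervalIntegral.integral_add (f := fun u => M * C * M * ‖Δ u‖ + M * C * q u)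
      ((hi1.add hi2).intervalIntegrable 0 t) intervalIntegrable_const, intervalIntegral.integral_add (hi1.intervalIntegrable 0 t)
      (hi2.intervalIntegrable 0 t), intervalIntegral.integral_const_mul,
      intervalIntegral.integral_const_mul, intervalIntegral.integral_const, sub_zero,
      smul_eq_mul] at hI
  refine (norm_add_le_of_le (norm_mul_le_of_le (hγ t ht) (hK t ht)) hI).trans ?_
  have h3 : t * (γ * (Cm * K)) ≤ T * (γ * (Cm * K)) :=
    mul_le_mul_of_nonneg_right ht.2 (by positivity)
  have h4 : M * C * ∫ u in (0 : ℝ)..t, q u ≤ M * C * ∫ u in (0 : ℝ)..T, q u :=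
    mul_le_mul_of_nonneg_left hqi (by positivity)
  linarith

/-- Quantitative adiabatic estimate. -/
theorem exists_norm_propagator_sub_le {L P : 𝔸} (hLP : Commute L P) (hPP : P * P = P)
    (hL : ∀ t : ℝ, 0 ≤ t → ‖NormedSpace.exp (t • L)‖ ≤ 1) {M : ℝ}
    (hM : ∀ t : ℝ, ‖NormedSpace.exp (t • L) * P‖ ≤ M) {M' η : ℝ} (hη : 0 < η)
    (hM' : ∀ t : ℝ, 0 ≤ t → ‖NormedSpace.exp (t • L) * (1 - P)‖ ≤ M' * Real.exp (-(η * t)))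
    {m V : ℝ → 𝔸} (hm : Continuous m) {Cm : ℝ} (hCm : ∀ t, ‖m t‖ ≤ Cm)
    (hPm : ∀ t, P * m t = m t) (hmP : ∀ t, m t * P = m t)
    (hV : ∀ u, HasDerivAt V (m u * V u) u) (hV0 : V 0 = 1) (C T : ℝ) :
    ∃ K : ℝ, ∀ κ > 0, ∀ d U : ℝ → 𝔸, Continuous d → (∀ t, ‖d t‖ ≤ C) →
      (∀ u, HasDerivAt U ((κ • L + d u) * U u) u) → U 0 = 1 → ∀ γ : ℝ,
      (∀ t ∈ Icc 0 T, ‖∫ u in (0 : ℝ)..t, (rotatingGenerator L P (d u) (κ * u) - m u)‖ ≤ γ) →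
      ∀ t ∈ Icc 0 T, ‖U t - NormedSpace.exp ((κ * t) • L) * V t‖ ≤ K * (κ⁻¹ + γ) := by
  have hVc : Continuous V := continuous_iff_continuousAt.2 fun u => (hV u).continuousAt
  obtain ⟨KV, hKV⟩ := (isCompact_Icc (a := 0) (b := T)).exists_bound_of_continuousOn
    (hVc.const_mul P).continuousOn
  set c := M' * C * Real.exp (C * T) * η⁻¹ with hc
  set X := Real.exp (M * C * M * T) with hX
  set c₁ := KV * (1 + T * Cm) with hc₁
  set c₂ := M * C * (M' * η⁻¹ + c * T) with hc₂
  refine ⟨c + M * (c₁ + c₂) * X, fun κ hκ d U hd hC hU hU0 γ hγ t ht => ?_⟩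
  have hT0 : 0 ≤ T := ht.1.trans ht.2
  have hC0 : 0 ≤ C := (norm_nonneg _).trans (hC 0)
  have hM0 : 0 ≤ M := (norm_nonneg _).trans (hM 0)
  have hM'0 : 0 ≤ M' := by simpa using (norm_nonneg _).trans (hM' 0 le_rfl)
  have hK0 : 0 ≤ KV := (norm_nonneg _).trans (hKV t ht)
  have hCm0 : 0 ≤ Cm := (norm_nonneg _).trans (hCm 0)
  have hγ0 : 0 ≤ γ := (norm_nonneg _).trans (hγ t ht)
  have hc0 : 0 ≤ c := by positivity
  have hc₁0 : 0 ≤ c₁ := by positivity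
  have hc₂0 : 0 ≤ c₂ := by positivity
  have hκi : 0 < κ⁻¹ := inv_pos.2 hκ
  have hUK := norm_propagator_le hL (T := T) hκ hd hC hU hU0
  have hR : Commute L (1 - P) := (Commute.one_right L).sub_right hLP
  have htr : ∀ t ∈ Icc 0 T, ‖(1 - P) * U t - NormedSpace.exp ((κ * t) • L) * (1 - P)‖
      ≤ c * κ⁻¹ := fun t ht => norm_transverse_sub_le hR hη hM' hκ hd hC hU hU0 hUK ht
  set q : ℝ → ℝ := fun u => M' * Real.exp (-(η * κ * u)) + c * κ⁻¹ with hq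
  have hqc : Continuous q := by fun_prop
  have hQ : ∀ t ∈ Icc 0 T, ‖(1 - P) * U t‖ ≤ q t := by
    intro t ht
    have h1 := hM' (κ * t) (mul_nonneg hκ.le ht.1)
    rw [← mul_assoc] at h1
    have h2 := norm_add_le_of_le h1 (htr t ht)
    rwa [add_sub_cancel] at h2
  have hqi : ∫ u in (0 : ℝ)..T, q u ≤ (M' * η⁻¹ + c * T) * κ⁻¹ := by
    rw [intervalIntegral.integral_add (Continuous.intervalIntegrable (by fun_prop) _ _)
      intervalIntegrable_const, intervalIntegral.integral_const_mul,
      intervalIntegral.integral_const, sub_zero, smul_eq_mul]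
    have := mul_le_mul_of_nonneg_left (integral_exp_neg_mul_le (mul_pos hη hκ) T) hM'0
    rw [mul_inv] at this
    linarith
  have hslow := norm_rotating_sub_slow_le hLP hPP hM hd hC hU hU0 hm hCm hPm hmP hV hV0 hKV hγ
    hqc hQ ht
  have hslow' : ‖NormedSpace.exp ((-(κ * t)) • L) * P * U t - P * V t‖ ≤
      (c₁ + c₂) * X * (κ⁻¹ + γ) := by
    refine hslow.trans ?_
    calc _ ≤ (γ * c₁ + c₂ * κ⁻¹) * X := by
          refine mul_le_mul (add_le_add (by rw [hc₁]; linarith) ?_) ?_ (Real.exp_pos _).le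
            (by positivity)
          · rw [hc₂, mul_assoc (M * C)]
            exact mul_le_mul_of_nonneg_left hqi (by positivity)
          · exact Real.exp_le_exp.2 (mul_le_mul_of_nonneg_left ht.2 (by positivity))
      _ ≤ (c₁ + c₂) * (κ⁻¹ + γ) * X := by
          refine mul_le_mul_of_nonneg_right ?_ (Real.exp_pos _).le
          nlinarith [mul_nonneg hc₁0 hκi.le, mul_nonneg hc₂0 hγ0]
      _ = _ := by ring
  set e := NormedSpace.exp ((κ * t) • L) with he
  have h1 : e * NormedSpace.exp ((-(κ * t)) • L) = 1 := by
    have h := exp_neg_smul_mul_exp_smul L (-(κ * t))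
    rwa [neg_neg] at h
  have hPe : e * P = P * e := (hLP.exp_smul_left _).eq
  -- The transverse parts match because `V` acts trivially there: `e(1 - P)V = e(1 - P)`. The slow
  -- parts match after undoing the rotation.
  have hsplit : U t - e * V t = ((1 - P) * U t - e * (1 - P)) +
      e * P * (NormedSpace.exp ((-(κ * t)) • L) * P * U t - P * V t) := by
    have h2 : e * P * (NormedSpace.exp ((-(κ * t)) • L) * P * U t) = P * U t := by
      calc _ = P * (e * NormedSpace.exp ((-(κ * t)) • L)) * P * U t := by
            rw [hPe]; simp only [mul_assoc]
        _ = _ := by rw [h1, mul_one, hPP]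
    have h3 : e * P * (P * V t) = e * (P * V t) := by
      rw [mul_assoc, ← mul_assoc P P, hPP]
    have h4 : e * (1 - P) = e * ((1 - P) * V t) := by rw [proj_mul_propagator_slow hPm hV hV0 t]
    rw [mul_sub (e * P), h2, h3, h4]
    noncomm_ring
  rw [hsplit]
  refine (norm_add_le_of_le (htr t ht) (norm_mul_le_of_le (hM _) hslow')).trans ?_
  have := mul_nonneg hc0 hγ0
  linarith

end Slow

/-! ### Extension from the half strip to the plane. -/

section Extension

variable {X : Type*} [NormedAddCommGroup X] [NormedSpace ℝ X] [CompleteSpace X]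

/-- A function which is `C¹` on a half strip agrees there with a function on the plane that has a
jointly continuous partial derivative in the first variable. -/
theorem exists_extension_of_contDiffOn {T : ℝ} (hT : 0 < T) {D : ℝ → ℝ → X}
    (hD : ContDiffOn ℝ 1 (fun p : ℝ × ℝ => D p.1 p.2) (Icc 0 T ×ˢ Ici 0)) :
    ∃ D' D₁ : ℝ → ℝ → X, Continuous ↿D' ∧ Continuous ↿D₁ ∧
      (∀ t s, HasDerivAt (fun r => D' r s) (D₁ t s) t) ∧
      ∀ t ∈ Icc 0 T, ∀ s ∈ Ici (0 : ℝ), D' t s = D t s := by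
  set S : Set (ℝ × ℝ) := Icc 0 T ×ˢ Ici 0 with hS
  set f : ℝ × ℝ → X := fun p => D p.1 p.2 with hf
  have hSu : UniqueDiffOn ℝ S := (uniqueDiffOn_Icc hT).prod (uniqueDiffOn_Ici 0)
  have hg : ContinuousOn (fun p => fderivWithin ℝ f S p (1, 0)) S :=
    (hD.continuousOn_fderivWithin hSu le_rfl).clm_apply continuousOn_const
  set c : ℝ → ℝ := fun t => projIcc 0 T hT.le t with hc
  have hcc : Continuous c := continuous_projIcc.subtype_val
  set D₁ : ℝ → ℝ → X := fun t s => fderivWithin ℝ f S (c t, max s 0) (1, 0) with hD₁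
  have hD₁c : Continuous ↿D₁ :=
    hg.comp_continuous (f := fun p : ℝ × ℝ => (c p.1, max p.2 0)) (by fun_prop)
      fun p => ⟨(projIcc 0 T hT.le p.1).2, mem_Ici.2 (le_max_right _ _)⟩
  have hD₁s : ∀ s, Continuous fun r => D₁ r s := fun s =>
    hD₁c.comp (by fun_prop : Continuous fun r : ℝ => (r, s))
  -- Clamp the `t`-derivative to the strip and integrate it from the edge `t = 0`. Only this
  -- derivative is needed, so smoothness in `s` may be lost.
  refine ⟨fun t s => f (0, max s 0) + ∫ r in (0 : ℝ)..t, D₁ r s, D₁, ?_, hD₁c, ?_, ?_⟩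
  · have h1 : Continuous fun p : ℝ × ℝ => f (0, max p.2 0) :=
      hD.continuousOn.comp_continuous (f := fun p : ℝ × ℝ => ((0 : ℝ), max p.2 0)) (by fun_prop)
        fun p => ⟨⟨le_rfl, hT.le⟩, mem_Ici.2 (le_max_right _ _)⟩
    have h2 : Continuous fun p : ℝ × ℝ => ∫ r in (0 : ℝ)..p.1, D₁ r p.2 :=
      intervalIntegral.continuous_parametric_intervalIntegral_of_continuous
        (f := fun (p : ℝ × ℝ) r => D₁ r p.2)
        (hD₁c.comp (by fun_prop : Continuous fun q : (ℝ × ℝ) × ℝ => (q.2, q.1.2))) continuous_fst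
    exact h1.add h2
  · intro t s
    exact ((hD₁s s).integral_hasStrictDerivAt 0 t).hasDerivAt.const_add _
  · intro t ht s hs
    have hs' : max s 0 = s := max_eq_left hs
    have hline : MapsTo (fun r : ℝ => (r, s)) (Icc 0 T) S := fun r hr => ⟨hr, hs⟩
    have hcont : ContinuousOn (fun r => D r s) (Icc 0 t) :=
      (hD.continuousOn.comp (f := fun r : ℝ => (r, s)) (by fun_prop) hline).mono
        (Icc_subset_Icc_right ht.2)
    have hint := intervalIntegral.integral_eq_sub_of_hasDerivAt_of_le ht.1 hcont
      (f' := fun r => D₁ r s) (fun r hr => ?_) ((hD₁s s).intervalIntegrable _ _)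
    · simp only [hint, hf, hs']
      abel
    · have hrT : r ∈ Ioo 0 T := ⟨hr.1, hr.2.trans_le ht.2⟩
      have hr' : r ∈ Icc 0 T := Ioo_subset_Icc_self hrT
      have h1 := ((hD.differentiableOn one_ne_zero) (r, s) (hline hr')).hasFDerivWithinAt
      have h2 : HasDerivWithinAt (fun r : ℝ => (r, s)) (1, 0) (Icc 0 T) r :=
        ((hasDerivAt_id r).prodMk (hasDerivAt_const r s)).hasDerivWithinAt
      have h3 := (h1.comp_hasDerivWithinAt r h2 hline).hasDerivAt (Icc_mem_nhds hrT.1 hrT.2)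
      have hcr : c r = r := by simp [hc, projIcc_of_mem hT.le hr']
      simp only [hD₁, hs', hcr]
      exact h3

end Extension

/-! ### Averages of the rotating generator. -/

section Rotating

variable {𝔸 : Type*} [NormedRing 𝔸] [NormedAlgebra ℝ 𝔸] [CompleteSpace 𝔸]

theorem continuous_uncurry_rotatingGenerator {L P : 𝔸} {D : ℝ → ℝ → 𝔸} (hD : Continuous ↿D) :
    Continuous ↿(fun t s => rotatingGenerator L P (D t s) s) := by
  have h1 := (continuous_exp_smul L).comp (by fun_prop : Continuous fun p : ℝ × ℝ => -p.2)
  have h2 := (continuous_exp_smul L).comp (by fun_prop : Continuous fun p : ℝ × ℝ => p.2)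
  exact (((h1.mul_const P).mul hD).mul_const P).mul h2

omit [CompleteSpace 𝔸] in
theorem hasDerivAt_rotatingGenerator {L P : 𝔸} {D : ℝ → 𝔸} {D' : 𝔸} {t : ℝ}
    (hD : HasDerivAt D D' t) (s : ℝ) :
    HasDerivAt (fun r => rotatingGenerator L P (D r) s) (rotatingGenerator L P D' s) t :=
  ((hD.const_mul _).mul_const _).mul_const _

omit [CompleteSpace 𝔸] in
theorem proj_mul_rotatingGenerator {L P : 𝔸} (hLP : Commute L P) (hPP : P * P = P) (d : 𝔸)
    (s : ℝ) : P * rotatingGenerator L P d s = rotatingGenerator L P d s := by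
  have h : P * (NormedSpace.exp ((-s) • L) * P) = NormedSpace.exp ((-s) • L) * P := by
    rw [(hLP.exp_smul_left _).eq, ← mul_assoc, hPP]
  simp only [rotatingGenerator, ← mul_assoc] at h ⊢
  rw [h]

omit [CompleteSpace 𝔸] in
theorem rotatingGenerator_mul_proj {L P : 𝔸} (hLP : Commute L P) (hPP : P * P = P) (d : 𝔸)
    (s : ℝ) : rotatingGenerator L P d s * P = rotatingGenerator L P d s := by
  simp only [rotatingGenerator, mul_assoc]
  rw [(hLP.exp_smul_left _).eq, ← mul_assoc P P, hPP]

section Averages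

variable {L P : 𝔸} {T : ℝ} {D : ℝ → ℝ → 𝔸} {Dbar : ℝ → 𝔸}

/-- Each finite-time average is fixed by `P` on both sides, and this survives the limit. -/
theorem proj_mul_average (hLP : Commute L P) (hPP : P * P = P)
    (hD : ContinuousOn (fun p : ℝ × ℝ => D p.1 p.2) (Icc 0 T ×ˢ Ici 0))
    (havg : TendstoUniformlyOn
      (fun τ t => τ⁻¹ • ∫ s in (0 : ℝ)..τ, rotatingGenerator L P (D t s) s) Dbar atTop (Icc 0 T))
    {t : ℝ} (ht : t ∈ Icc 0 T) : P * Dbar t = Dbar t ∧ Dbar t * P = Dbar t := by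
  have hlim := havg.tendsto_at ht
  have hint : ∀ τ, 0 ≤ τ → IntervalIntegrable (fun s => rotatingGenerator L P (D t s) s)
      MeasureTheory.volume 0 τ := by
    intro τ hτ
    have h1 := (continuous_exp_smul L).comp (by fun_prop : Continuous fun s : ℝ => -s)
    have h2 : ContinuousOn (fun s => D t s) (Icc 0 τ) :=
      hD.comp (f := fun s => (t, s)) (by fun_prop) fun s hs => ⟨ht, hs.1⟩
    exact ((((h1.mul_const P).continuousOn.mul h2).mul continuousOn_const).mul
      (continuous_exp_smul L).continuousOn).intervalIntegrable_of_Icc hτ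
  constructor
  · refine tendsto_nhds_unique (hlim.const_mul P) (hlim.congr' ?_)
    filter_upwards [eventually_ge_atTop 0] with τ hτ
    have := (ContinuousLinearMap.mul ℝ 𝔸 P).intervalIntegral_comp_comm (hint τ hτ)
    simp only [ContinuousLinearMap.mul_apply', proj_mul_rotatingGenerator hLP hPP] at this
    rw [mul_smul_comm, ← this]
  · refine tendsto_nhds_unique (hlim.mul_const P) (hlim.congr' ?_)
    filter_upwards [eventually_ge_atTop 0] with τ hτ
    have := ((ContinuousLinearMap.mul ℝ 𝔸).flip P).intervalIntegral_comp_comm (hint τ hτ)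
    simp only [ContinuousLinearMap.flip_apply, ContinuousLinearMap.mul_apply',
      rotatingGenerator_mul_proj hLP hPP] at this
    rw [smul_mul_assoc, ← this]

theorem eventually_norm_integral_rotatingGenerator_sub_le (hT : 0 < T)
    (hD : ContDiffOn ℝ 1 (fun p : ℝ × ℝ => D p.1 p.2) (Icc 0 T ×ˢ Ici 0))
    (havg : TendstoUniformlyOn
      (fun τ t => τ⁻¹ • ∫ s in (0 : ℝ)..τ, rotatingGenerator L P (D t s) s) Dbar atTop (Icc 0 T))
    (hDbar : DifferentiableOn ℝ Dbar (Icc 0 T))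
    (havg' : TendstoUniformlyOn
      (fun τ t => derivWithin
        (fun r => τ⁻¹ • ∫ s in (0 : ℝ)..τ, rotatingGenerator L P (D r s) s) (Icc 0 T) t)
      (fun t => derivWithin Dbar (Icc 0 T) t) atTop (Icc 0 T)) {ε : ℝ} (hε : 0 < ε) :
    ∀ᶠ κ in atTop, ∀ t ∈ Icc 0 T,
      ‖∫ u in (0 : ℝ)..t, (rotatingGenerator L P (D u (κ * u)) (κ * u) - Dbar u)‖ ≤ ε := by
  obtain ⟨D', D₁, hD'c, hD₁c, hD'd, hD'⟩ := exists_extension_of_contDiffOn hT hD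
  have hFc := continuous_uncurry_rotatingGenerator (L := L) (P := P) hD'c
  have hF₁c := continuous_uncurry_rotatingGenerator (L := L) (P := P) hD₁c
  have hFd := fun t s => hasDerivAt_rotatingGenerator (L := L) (P := P) (hD'd t s) s
  have heq : ∀ τ, 0 ≤ τ → EqOn
      (fun t => τ⁻¹ • ∫ s in (0 : ℝ)..τ, rotatingGenerator L P (D t s) s)
      (fun t => τ⁻¹ • ∫ s in (0 : ℝ)..τ, rotatingGenerator L P (D' t s) s) (Icc 0 T) := by
    intro τ hτ t ht
    refine congrArg _ (intervalIntegral.integral_congr fun s hs => ?_)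
    rw [uIcc_of_le hτ] at hs
    simp only [hD' t ht s hs.1]
  have heq' : ∀ τ, 0 ≤ τ → EqOn
      (fun t => derivWithin
        (fun r => τ⁻¹ • ∫ s in (0 : ℝ)..τ, rotatingGenerator L P (D r s) s) (Icc 0 T) t)
      (fun t => τ⁻¹ • ∫ s in (0 : ℝ)..τ, rotatingGenerator L P (D₁ t s) s) (Icc 0 T) := by
    intro τ hτ t ht
    have h1 := (hasDerivAt_integral_param hFc hF₁c hFd τ t).const_smul τ⁻¹
    exact (h1.hasDerivWithinAt.congr (heq τ hτ) (heq τ hτ ht)).derivWithin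
      (uniqueDiffOn_Icc hT t ht)
  have hlim := havg.congr ((eventually_ge_atTop 0).mono heq)
  have hlim' := havg'.congr ((eventually_ge_atTop 0).mono heq')
  -- The limit family is only assumed differentiable; its derivative is continuous as a uniform
  -- limit of continuous functions.
  have hDbar' : ContinuousOn (derivWithin Dbar (Icc 0 T)) (Icc 0 T) :=
    hlim'.continuousOn (.of_forall fun τ => (((continuous_integral_param hF₁c).comp
      (by fun_prop : Continuous fun t : ℝ => (t, τ))).const_smul τ⁻¹).continuousOn)
  filter_upwards [eventually_ge_atTop 0, tendstoUniformlyOn_integral_diagonal hT hFc hF₁c hFd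
    hDbar.continuousOn hDbar' (fun t ht => (hDbar t (Ioo_subset_Icc_self ht)).hasDerivWithinAt
      |>.hasDerivAt (Icc_mem_nhds ht.1 ht.2)) hlim hlim' hε] with κ hκ h t ht
  refine le_of_eq_of_le (congrArg _ (intervalIntegral.integral_congr fun u hu => ?_)) (h t ht)
  rw [uIcc_of_le ht.1] at hu
  simp only [hD' u ⟨hu.1, hu.2.trans ht.2⟩ (κ * u) (mul_nonneg hκ hu.1)]

end Averages

end Rotating

/-! ### Adiabatic limit of the time-ordered exponentials. -/

section Propagator

variable {E : Type*} [NormedAddCommGroup E] [NormedSpace ℂ E] [CompleteSpace E]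

/-- The adiabatic estimate for time-ordered exponentials with generators given on `[0, T]`. -/
theorem exists_norm_timeOrderedExp_sub_le {T : ℝ} (hT : 0 < T) {L P : E →L[ℂ] E}
    (hLP : Commute L P) (hPP : P * P = P)
    (hL : ∀ t : ℝ, 0 ≤ t → ‖NormedSpace.exp (t • L)‖ ≤ 1) {M : ℝ}
    (hM : ∀ t : ℝ, ‖NormedSpace.exp (t • L) * P‖ ≤ M) {M' η : ℝ} (hη : 0 < η)
    (hM' : ∀ t : ℝ, 0 ≤ t → ‖NormedSpace.exp (t • L) * (1 - P)‖ ≤ M' * Real.exp (-(η * t)))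
    {m : ℝ → E →L[ℂ] E} (hm : ContinuousOn m (Icc 0 T))
    (hPm : ∀ t ∈ Icc 0 T, P * m t = m t ∧ m t * P = m t) (C : ℝ) :
    ∃ K : ℝ, ∀ κ > 0, ∀ d : ℝ → E →L[ℂ] E, ContinuousOn d (Icc 0 T) →
      (∀ t ∈ Icc 0 T, ‖d t‖ ≤ C) → ∀ γ : ℝ,
      (∀ t ∈ Icc 0 T, ‖∫ u in (0 : ℝ)..t, (rotatingGenerator L P (d u) (κ * u) - m u)‖ ≤ γ) →
      ∀ t ∈ Icc 0 T, ‖timeOrderedExp (fun s => κ • L + d s) 0 t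
        - NormedSpace.exp ((κ * t) • L) * timeOrderedExp m 0 t‖ ≤ K * (κ⁻¹ + γ) := by
  -- Clamping time to `[0, T]` makes the generators continuous and bounded on the line without
  -- changing the propagators on `[0, T]`.
  set c : ℝ → ℝ := fun t => projIcc 0 T hT.le t with hc
  have hcc : Continuous c := continuous_projIcc.subtype_val
  have hcm : ∀ t, c t ∈ Icc 0 T := fun t => (projIcc 0 T hT.le t).2
  have hce : ∀ t ∈ Icc 0 T, c t = t := fun t ht => by simp [hc, projIcc_of_mem hT.le ht]
  have hmc : Continuous fun t => m (c t) := hm.comp_continuous hcc hcm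
  obtain ⟨Cm, hCm⟩ := isCompact_Icc.exists_bound_of_continuousOn hm
  have hmb : ∀ t, ‖m (c t)‖ ≤ Cm := fun t => hCm _ (hcm t)
  obtain ⟨K, hK⟩ := exists_norm_propagator_sub_le hLP hPP hL hM hη hM' hmc hmb
    (fun t => (hPm _ (hcm t)).1) (fun t => (hPm _ (hcm t)).2) (hasDerivAt_timeOrderedExp hmc hmb)
    (timeOrderedExp_zero _) C T
  refine ⟨K, fun κ hκ d hd hC γ hγ t ht => ?_⟩
  have hdc : Continuous fun t => d (c t) := hd.comp_continuous hcc hcm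
  have hdb : ∀ t, ‖d (c t)‖ ≤ C := fun t => hC _ (hcm t)
  have hU := hasDerivAt_timeOrderedExp (A := fun t => κ • L + d (c t)) (hdc.const_add _)
    (M := ‖κ • L‖ + C) fun t => norm_add_le_of_le le_rfl (hdb t)
  have hmeq : ∀ s ∈ Icc 0 T, m s = m (c s) := fun s hs => by rw [hce s hs]
  have hdeq : ∀ s ∈ Icc 0 T, κ • L + d s = κ • L + d (c s) := fun s hs => by rw [hce s hs]
  rw [timeOrderedExp_congr hmeq ht, timeOrderedExp_congr hdeq ht]
  refine hK κ hκ _ _ hdc hdb hU (timeOrderedExp_zero _) γ (fun t ht => ?_) t ht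
  refine le_of_eq_of_le (congrArg _ (intervalIntegral.integral_congr fun u hu => ?_)) (hγ t ht)
  rw [uIcc_of_le ht.1] at hu
  simp only [hce u ⟨hu.1, hu.2.trans ht.2⟩]

end Propagator

theorem corollary5 {E : Type*} [NormedAddCommGroup E] [NormedSpace ℂ E] [FiniteDimensional ℂ E]
    (T : ℝ) (hT : 0 < T)
    (L₀ : E →L[ℂ] E) (hL₀ : GeneratesContractionSemigroup L₀)
    (D : ℝ → ℝ → E →L[ℂ] E)
    (hD_smooth : ContDiffOn ℝ 1 (fun p : ℝ × ℝ => D p.1 p.2) (Icc 0 T ×ˢ Ici 0))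
    (hD_bdd : ∃ C : ℝ, ∀ t ∈ Icc 0 T, ∀ s ∈ Ici (0 : ℝ), ‖D t s‖ ≤ C)
    (Dbar : ℝ → E →L[ℂ] E)
    (h_avg : TendstoUniformlyOn (fun τ t => rotatingAverage L₀ D τ t) Dbar atTop (Icc 0 T))
    (hDbar_diff : DifferentiableOn ℝ Dbar (Icc 0 T))
    (h_avg_deriv : TendstoUniformlyOn
      (fun τ t => derivWithin (fun r => rotatingAverage L₀ D τ r) (Icc 0 T) t)
      (fun t => derivWithin Dbar (Icc 0 T) t) atTop (Icc 0 T)) :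
    TendstoUniformlyOn
      (fun κ t => timeOrderedExp (fun s => κ • L₀ + D s (κ * s)) 0 t
        - NormedSpace.exp ((κ * t) • L₀) * timeOrderedExp Dbar 0 t)
      (fun _ => 0) atTop (Icc 0 T) := by
  have : CompleteSpace E := FiniteDimensional.complete ℂ E
  obtain ⟨M, hM⟩ := exists_norm_exp_mul_peripheralProjection_le hL₀
  obtain ⟨η, hη, M', hM'⟩ := exists_norm_exp_mul_one_sub_peripheralProjection_le hL₀
  obtain ⟨C, hC⟩ := hD_bdd
  have hLP := commute_peripheralProjection L₀
  have hPP := peripheralProjection_mul_self L₀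
  obtain ⟨K, hK⟩ := exists_norm_timeOrderedExp_sub_le hT hLP hPP hL₀ hM hη hM'
    hDbar_diff.continuousOn
    (fun t ht => proj_mul_average hLP hPP hD_smooth.continuousOn h_avg ht) C
  rw [Metric.tendstoUniformlyOn_iff]
  intro ε hε
  -- Both `κ⁻¹` and the integrated fluctuation are kept within `δ`. The sign of `K` is unknown,
  -- hence `|K|`; the `+ 1` avoids division by zero and makes the final inequality strict.
  set δ := ε / (2 * (|K| + 1)) with hδ
  have hδ0 : 0 < δ := by positivity
  filter_upwards [eventually_gt_atTop 0, 
    eventually_norm_integral_rotatingGenerator_sub_le hT hD_smooth h_avg hDbar_diff h_avg_deriv hδ0,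
    tendsto_inv_atTop_zero.eventually_lt_const hδ0] with κ hκ hγ hκδ t ht
  rw [dist_zero_left]
  have hmaps : MapsTo (fun s : ℝ => (s, κ * s)) (Icc 0 T) (Icc 0 T ×ˢ Ici 0) :=
    fun s hs => ⟨hs, mem_Ici.2 (mul_nonneg (le_of_lt hκ) hs.1)⟩
  have hd : ContinuousOn (fun s => D s (κ * s)) (Icc 0 T) :=
    hD_smooth.continuousOn.comp (f := fun s : ℝ => (s, κ * s)) (by fun_prop) hmaps
  calc _ ≤ K * (κ⁻¹ + δ) :=
        hK κ hκ _ hd (fun s hs => hC s hs _ (hmaps hs).2) δ hγ t ht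
    _ ≤ |K| * (δ + δ) := by
        have := inv_pos.2 hκ
        gcongr
        exact le_abs_self K
    _ < (|K| + 1) * (δ + δ) := by
        have : 0 < δ + δ := by positivity
        gcongr
        exact lt_add_one _
    _ = ε := by rw [hδ]; field_simp; ring
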